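/- Let $B,R>0$ and let $V\subset\mathbb{R}^2$ be a discrete set of points whose minimal distance $L=\inf\{|\alpha-\beta| : \alpha,\beta\in V,\ \alpha\neq\beta\}$ satisfies $L>2R$ (with $L=+\infty$ if $V$ has at most one point). Put $\Omega_V=\mathbb{R}^2\setminus\bigcup_{\alpha\in V}D(\alpha,R)$, where $D(\alpha,R)$ is the closed disk with centre $\alpha$ and radius $R$, and $A(x)=\big(-\tfrac B2x_2,\tfrac B2x_1\big)$. For $h>0$, let $\mathscr L_h^V$ be the magnetic Neumann realization of $(-ih\nabla-A)^2$ on $\Omega_V$, that is, the self-adjoint operator on $L^2(\Omega_V)$ associated with the closed quadratic form $u\mapsto\int_{\Omega_V}|(-ih\nabla-A)u|^2\,dx$ with domain $\{u\in L^2(\Omega_V): (-ih\nabla-A)u\in L^2(\Omega_V)\}$. Let $\Theta_0=\inf_{\xi\in\mathbb{R}}\mu(\xi)\in(0,1)$ be the de Gennes constant, where $\mu(\xi)$ is the lowest eigenvalue of the Neumann realization of $-\frac{d^2}{dt^2}+(t-\xi)^2$ on $L^2(0,\infty)$. There exist $\kappa,C,h_0>0$ such that, for every $h\in(0,h_0)$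 and every $\Psi\in L^2(\Omega_V)$ with $\Psi=\mathbf 1_{(-\infty,\frac{1+\Theta_0}{2}Bh]}(\mathscr L_h^V)\Psi$, the distribution $(-ih\nabla-A)\Psi$ belongs to $L^2(\Omega_V)$ and \[ \int_{\Omega_V} e^{\frac{\kappa}{\sqrt h}\mathfrak d(x,\partial\Omega_V)}\Big(|\Psi|^2+h^{-1}|(-ih\nabla-A)\Psi|^2\Big)\,dx\le C\,\|\Psi\|^2, \] where $\mathfrak d(x,\partial\Omega_V)$ is the Euclidean distance from $x$ to $\partial\Omega_V$ (the value in the case $V=\emptyset$ is immaterial). -/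

import Mathlib

open MeasureTheory Set
open scoped ENNReal ContDiff

/-! ### Spectral projections of (unbounded) self-adjoint operators -/

/-- A projection-valued measure on the Borel sets of `ℝ`, with values in the orthogonal projections
of the Hilbert space `H` (the values at non-measurable sets are irrelevant). -/
structure SpectralResolution (H : Type*) [NormedAddCommGroup H] [InnerProductSpace ℂ H]
    [CompleteSpace H] where
  proj : Set ℝ → H →L[ℂ] H
  isStarProjection : ∀ S, MeasurableSet S → IsStarProjection (proj S)
  proj_univ : proj univ = 1
  proj_inter : ∀ S T, MeasurableSet S → MeasurableSet T → proj (S ∩ T) = proj S * proj T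
  hasSum_iUnion : ∀ S : ℕ → Set ℝ, (∀ n, MeasurableSet (S n)) →
    Pairwise (Function.onFun Disjoint S) → ∀ x : H, HasSum (fun n => proj (S n) x)
      (proj (⋃ n, S n) x)

namespace SpectralResolution

variable {H : Type*} [NormedAddCommGroup H] [InnerProductSpace ℂ H] [CompleteSpace H]

lemma inner_proj_eq (E : SpectralResolution H) (x : H) {S : Set ℝ} (hS : MeasurableSet S) :
    (inner ℂ x (E.proj S x)).re = ‖E.proj S x‖ ^ 2 := by
  have hp := E.isStarProjection S hS
  have h1 : E.proj S (E.proj S x) = E.proj S x :=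
    congrArg (fun T : H →L[ℂ] H => T x) hp.isIdempotentElem
  have h2 : inner ℂ (E.proj S x) (E.proj S x) = inner ℂ x (E.proj S (E.proj S x)) := by
    rw [← ContinuousLinearMap.adjoint_inner_right, ← ContinuousLinearMap.star_eq_adjoint,
      hp.isSelfAdjoint.star_eq]
  rw [h1] at h2
  rw [← h2, inner_self_eq_norm_sq_to_K]
  norm_cast

/-- The scalar spectral measure `S ↦ ⟨x, E(S) x⟩ = ‖E(S) x‖²` of a vector `x`. -/
noncomputable def scalarMeasure (E : SpectralResolution H) (x : H) : Measure ℝ :=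
  Measure.ofMeasurable (fun S _ => ENNReal.ofReal (inner ℂ x (E.proj S x)).re)
    (by
      have h := E.hasSum_iUnion (fun _ => ∅) (fun _ => MeasurableSet.empty)
        (fun _ _ _ => by simp [Function.onFun]) x
      have h0 : E.proj ∅ x = 0 := by
        have h1 := h.summable.tendsto_atTop_zero
        exact tendsto_nhds_unique tendsto_const_nhds h1
      simp [h0])
    (by
      intro S hS hd
      have h := (E.hasSum_iUnion S hS hd x).mapL (Complex.reCLM.comp
        ((innerSL ℂ x).restrictScalars ℝ))
      have h' : HasSum (fun n => (inner ℂ x (E.proj (S n) x)).re)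
          (inner ℂ x (E.proj (⋃ n, S n) x)).re := h
      rw [← h'.tsum_eq, ENNReal.ofReal_tsum_of_nonneg _ h'.summable]
      intro n
      rw [E.inner_proj_eq x (hS n)]
      positivity)

/-- `E` is the spectral resolution of the operator `T`, i.e. `T = ∫ t dE(t)`: the domain of `T`
consists of the vectors `x` with `∫ t² d⟨x, E(t) x⟩ < ∞`, and `⟨x, T x⟩ = ∫ t d⟨x, E(t) x⟩` on the
domain (which determines `T` by polarization). By the spectral theorem, each self-adjoint `T` has
exactly one such `E`. -/
def IsResolutionOf (E : SpectralResolution H) (T : H →ₗ.[ℂ] H) : Prop :=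
  (∀ x : H, x ∈ T.domain ↔ Integrable (fun t : ℝ => t ^ 2) (E.scalarMeasure x)) ∧
    ∀ x : T.domain, inner ℂ (x : H) (T x) = ((∫ t, t ∂(E.scalarMeasure (x : H)) : ℝ) : ℂ)

end SpectralResolution

open Classical in
/-- The spectral projection `𝟏_S(T)` of a self-adjoint operator `T` (with the junk value `0` if `T`
has no spectral resolution, which does not happen for self-adjoint `T`). -/
noncomputable def spectralProjection {H : Type*} [NormedAddCommGroup H] [InnerProductSpace ℂ H]
    [CompleteSpace H] (T : H →ₗ.[ℂ] H) (S : Set ℝ) : H →L[ℂ] H :=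
  if h : ∃ E : SpectralResolution H, E.IsResolutionOf T then h.choose.proj S else 0

/-! ### The de Gennes constant -/

/-- `u` is in the form domain `{u ∈ H¹(0,∞) : t u ∈ L²(0,∞)}` of the de Gennes operators, and `u'` is
its (almost everywhere) derivative. -/
def IsDeGennesForm (u u' : ℝ → ℂ) : Prop :=
  MemLp u 2 (volume.restrict (Ioi 0)) ∧ MemLp u' 2 (volume.restrict (Ioi 0)) ∧
    MemLp (fun t : ℝ => (t : ℂ) * u t) 2 (volume.restrict (Ioi 0)) ∧
    ∀ t : ℝ, 0 ≤ t → u t = u 0 + ∫ s in (0 : ℝ)..t, u' s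

/-- The lowest eigenvalue (bottom of the spectrum) of the Neumann realization of
`-d²/dt² + (t - ξ)²` on the half-line `(0,∞)`. -/
noncomputable def deGennesEnergy (ξ : ℝ) : ℝ :=
  sInf {E : ℝ | ∃ u u' : ℝ → ℂ, IsDeGennesForm u u' ∧ (∫ t in Ioi (0 : ℝ), ‖u t‖ ^ 2) = 1 ∧
    E = ∫ t in Ioi (0 : ℝ), (‖u' t‖ ^ 2 + (t - ξ) ^ 2 * ‖u t‖ ^ 2)}

/-- The de Gennes constant `Θ₀ = inf_ξ μ₁(ξ) ≈ 0.59`. -/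
noncomputable def deGennesConstant : ℝ := ⨅ ξ : ℝ, deGennesEnergy ξ

/-! ### The magnetic Neumann Laplacian in the complement of disks -/

/-- The Euclidean plane. -/
abbrev Plane : Type := EuclideanSpace ℝ (Fin 2)

/-- The plane with the disks of radius `R` centred at the points of `V` removed. -/
def obstacleDomain (V : Set Plane) (R : ℝ) : Set Plane := (⋃ α ∈ V, Metric.closedBall α R)ᶜ

/-- The Hilbert space `L²(Ω; ℂ)`. -/
abbrev L2 (Ω : Set Plane) : Type := Lp ℂ 2 (volume.restrict Ω)

/-- The vector potential `A(x) = (-B x₂ / 2, B x₁ / 2)` of the constant magnetic field `B`. -/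
noncomputable def vectorPotential (B : ℝ) (x : Plane) : Fin 2 → ℝ := ![-(B / 2) * x 1, B / 2 * x 0]

/-- The partial derivative `∂_j φ`. -/
noncomputable def partialDeriv (j : Fin 2) (φ : Plane → ℂ) (x : Plane) : ℂ :=
  fderiv ℝ φ x (EuclideanSpace.single j 1)

/-- `g = (-ih∇ - A) u` in the sense of distributions on `Ω`, where `u` and both components of `g`
are in `L²(Ω)`. -/
def IsMagneticGradient (B h : ℝ) (Ω : Set Plane) (u : L2 Ω) (g : Fin 2 → L2 Ω) : Prop :=
  ∀ j : Fin 2, ∀ φ : Plane → ℂ, ContDiff ℝ ∞ φ → HasCompactSupport φ → tsupport φ ⊆ Ω →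
    ∫ x in Ω, g j x * φ x =
      ∫ x in Ω, u x * (Complex.I * h * partialDeriv j φ x - vectorPotential B x j * φ x)

lemma partialDeriv_memLp (μ : Measure Plane) [IsFiniteMeasureOnCompacts μ] (j : Fin 2)
    {φ : Plane → ℂ} (hφ : ContDiff ℝ ∞ φ) (hc : HasCompactSupport φ) :
    MemLp (partialDeriv j φ) 2 μ := by
  have h1 : Continuous (partialDeriv j φ) :=
    (hφ.continuous_fderiv (by simp)).clm_apply continuous_const
  exact h1.memLp_of_hasCompactSupport
    (HasCompactSupport.fderiv_apply (𝕜 := ℝ) hc (EuclideanSpace.single j (1 : ℝ)))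

lemma vectorPotential_continuous (B : ℝ) (j : Fin 2) :
    Continuous fun x : Plane => vectorPotential B x j := by
  fin_cases j <;> simp [vectorPotential] <;> fun_prop

lemma magneticTest_memLp (μ : Measure Plane) [IsFiniteMeasureOnCompacts μ] (B h : ℝ) (j : Fin 2)
    {φ : Plane → ℂ} (hφ : ContDiff ℝ ∞ φ) (hc : HasCompactSupport φ) :
    MemLp (fun x => Complex.I * h * partialDeriv j φ x - vectorPotential B x j * φ x) 2 μ := by
  refine ((partialDeriv_memLp μ j hφ hc).const_mul _).sub ?_
  refine Continuous.memLp_of_hasCompactSupport ?_ hc.mul_left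
  exact (Complex.continuous_ofReal.comp (vectorPotential_continuous B j)).mul hφ.continuous

lemma integrable_L2_mul {Ω : Set Plane} (u : L2 Ω) {ψ : Plane → ℂ}
    (hψ : MemLp ψ 2 (volume.restrict Ω)) :
    Integrable (fun x => u x * ψ x) (volume.restrict Ω) :=
  (Lp.memLp u).integrable_mul hψ

lemma integral_add_mul {Ω : Set Plane} (u v : L2 Ω) {ψ : Plane → ℂ}
    (hψ : MemLp ψ 2 (volume.restrict Ω)) :
    ∫ x in Ω, (u + v : L2 Ω) x * ψ x = (∫ x in Ω, u x * ψ x) + ∫ x in Ω, v x * ψ x := by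
  rw [← integral_add (integrable_L2_mul u hψ) (integrable_L2_mul v hψ)]
  refine integral_congr_ae ?_
  filter_upwards [Lp.coeFn_add u v] with x hx
  simp only [hx, Pi.add_apply, add_mul]

lemma integral_smul_mul {Ω : Set Plane} (c : ℂ) (u : L2 Ω) (ψ : Plane → ℂ) :
    ∫ x in Ω, (c • u : L2 Ω) x * ψ x = c * ∫ x in Ω, u x * ψ x := by
  rw [← integral_const_mul]
  refine integral_congr_ae ?_
  filter_upwards [Lp.coeFn_smul c u] with x hx
  simp only [hx, Pi.smul_apply, smul_eq_mul, mul_assoc]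

lemma IsMagneticGradient.add {B h : ℝ} {Ω : Set Plane} {u v : L2 Ω} {g k : Fin 2 → L2 Ω}
    (hu : IsMagneticGradient B h Ω u g) (hv : IsMagneticGradient B h Ω v k) :
    IsMagneticGradient B h Ω (u + v) (g + k) := by
  intro j φ hφ hc hs
  rw [Pi.add_apply, integral_add_mul _ _ (hφ.continuous.memLp_of_hasCompactSupport hc),
    integral_add_mul _ _ (magneticTest_memLp _ B h j hφ hc), hu j φ hφ hc hs, hv j φ hφ hc hs]

lemma IsMagneticGradient.smul {B h : ℝ} {Ω : Set Plane} {u : L2 Ω} {g : Fin 2 → L2 Ω} (c : ℂ)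
    (hu : IsMagneticGradient B h Ω u g) : IsMagneticGradient B h Ω (c • u) (c • g) := by
  intro j φ hφ hc hs
  rw [Pi.smul_apply, integral_smul_mul, integral_smul_mul, hu j φ hφ hc hs]

lemma IsMagneticGradient.zero (B h : ℝ) (Ω : Set Plane) : IsMagneticGradient B h Ω 0 0 := by
  intro j φ hφ hc hs
  have h1 := integral_smul_mul (Ω := Ω) 0 0 φ
  have h2 := integral_smul_mul (Ω := Ω) 0 0
    (fun x => Complex.I * h * partialDeriv j φ x - vectorPotential B x j * φ x)
  simp only [zero_smul, zero_mul] at h1 h2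
  rw [Pi.zero_apply, h1, h2]

/-- The graph of the operator associated with the closed quadratic form
`u ↦ ‖(-ih∇ - A) u‖²` whose domain is the magnetic Sobolev space
`{u ∈ L²(Ω) : (-ih∇ - A) u ∈ L²(Ω)}`: the pair `(u, f)` belongs to it if `u` is in the form domain
and `⟨(-ih∇ - A) v, (-ih∇ - A) u⟩ = ⟨v, f⟩` for all `v` in the form domain. -/
noncomputable def magneticNeumannGraph (B h : ℝ) (Ω : Set Plane) :
    Submodule ℂ (L2 Ω × L2 Ω) where
  carrier := {p | ∃ g : Fin 2 → L2 Ω, IsMagneticGradient B h Ω p.1 g ∧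
    ∀ (v : L2 Ω) (k : Fin 2 → L2 Ω), IsMagneticGradient B h Ω v k →
      ∑ j, inner ℂ (k j) (g j) = inner ℂ v p.2}
  add_mem' := by
    rintro p q ⟨g, hg, hp⟩ ⟨g', hg', hq⟩
    refine ⟨g + g', hg.add hg', fun v k hk => ?_⟩
    simp only [Pi.add_apply, inner_add_right, Finset.sum_add_distrib, hp v k hk, hq v k hk,
      Prod.snd_add]
  zero_mem' := ⟨0, IsMagneticGradient.zero B h Ω, fun v k _ => by simp⟩
  smul_mem' := by
    rintro c p ⟨g, hg, hp⟩
    refine ⟨c • g, hg.smul c, fun v k hk => ?_⟩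
    simp only [Pi.smul_apply, inner_smul_right, ← Finset.mul_sum, hp v k hk, Prod.smul_snd]

lemma locallyIntegrableOn_L2 {Ω : Set Plane} (hΩ : IsOpen Ω) (g : L2 Ω) :
    LocallyIntegrableOn (fun x => g x) Ω volume := by
  rw [locallyIntegrableOn_iff hΩ.isLocallyClosed]
  intro K hK hc
  have h1 : LocallyIntegrable (fun x => g x) (volume.restrict Ω) :=
    (Lp.memLp g).locallyIntegrable (by norm_num)
  have h2 := h1.integrableOn_isCompact hc
  rwa [IntegrableOn, Measure.restrict_restrict_of_subset hK] at h2

lemma L2_eq_zero_of_test {Ω : Set Plane} (hΩ : IsOpen Ω) (g : L2 Ω)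
    (h : ∀ ψ : Plane → ℝ, ContDiff ℝ ∞ ψ → HasCompactSupport ψ → tsupport ψ ⊆ Ω →
      ∫ x in Ω, g x * (ψ x : ℂ) = 0) : g = 0 := by
  have h1 := hΩ.ae_eq_zero_of_integral_contDiff_smul_eq_zero
    (locallyIntegrableOn_L2 hΩ g) (fun ψ h1 h2 h3 => by
      rw [← h ψ h1 h2 h3, setIntegral_eq_integral_of_forall_compl_eq_zero]
      · refine integral_congr_ae (Filter.Eventually.of_forall fun x => ?_)
        simp [mul_comm]
      · intro x hx
        rw [image_eq_zero_of_notMem_tsupport (fun hx' => hx (h3 hx'))]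
        simp)
  rw [Lp.eq_zero_iff_ae_eq_zero]
  exact (ae_restrict_iff' hΩ.measurableSet).2 h1

lemma integral_toLp_mul {Ω : Set Plane} {F : Plane → ℂ} (hF : MemLp F 2 (volume.restrict Ω))
    (ψ : Plane → ℂ) : ∫ x in Ω, hF.toLp F x * ψ x = ∫ x in Ω, F x * ψ x := by
  refine integral_congr_ae ?_
  filter_upwards [hF.coeFn_toLp] with x hx
  rw [hx]

lemma isMagneticGradient_test (B h : ℝ) {Ω : Set Plane} {ψ : Plane → ℂ}
    (hψ : ContDiff ℝ ∞ ψ) (hc : HasCompactSupport ψ) :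
    IsMagneticGradient B h Ω ((hψ.continuous.memLp_of_hasCompactSupport hc).toLp ψ)
      (fun j => (((partialDeriv_memLp _ j hψ hc).const_mul (-(Complex.I * h))).sub
        (Continuous.memLp_of_hasCompactSupport
          ((Complex.continuous_ofReal.comp (vectorPotential_continuous B j)).mul hψ.continuous)
          hc.mul_left)).toLp _) := by
  intro j φ hφ hcφ hs
  rw [integral_toLp_mul, integral_toLp_mul]
  have hd : Differentiable ℝ ψ := hψ.differentiable (by simp)
  have hdφ : Differentiable ℝ φ := hφ.differentiable (by simp)
  have cψ : Continuous (partialDeriv j ψ) :=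
    (hψ.continuous_fderiv (by simp)).clm_apply continuous_const
  have cφ : Continuous (partialDeriv j φ) :=
    (hφ.continuous_fderiv (by simp)).clm_apply continuous_const
  have cA := Complex.continuous_ofReal.comp (vectorPotential_continuous B j)
  have hdc : HasCompactSupport (partialDeriv j φ) :=
    HasCompactSupport.fderiv_apply (𝕜 := ℝ) hcφ (EuclideanSpace.single j (1 : ℝ))
  have i1 : Integrable (fun x => partialDeriv j ψ x * φ x) (volume : Measure Plane) :=
    (cψ.mul hφ.continuous).integrable_of_hasCompactSupport hcφ.mul_left
  have i2 : Integrable (fun x => ψ x * partialDeriv j φ x) (volume : Measure Plane) :=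
    (hψ.continuous.mul cφ).integrable_of_hasCompactSupport hdc.mul_left
  have i3 : Integrable (fun x => ψ x * φ x) (volume : Measure Plane) :=
    (hψ.continuous.mul hφ.continuous).integrable_of_hasCompactSupport hcφ.mul_left
  have i4 : Integrable (fun x => (vectorPotential B x j : ℂ) * (ψ x * φ x))
      (volume : Measure Plane) :=
    (cA.mul (hψ.continuous.mul hφ.continuous)).integrable_of_hasCompactSupport
      hcφ.mul_left.mul_left
  have ibp : ∫ x, ψ x * partialDeriv j φ x = - ∫ x, partialDeriv j ψ x * φ x :=
    integral_mul_fderiv_eq_neg_fderiv_mul_of_integrable i1 i2 i3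
      (fun x _ => hd x) (fun x _ => hdφ x)
  have z : ∀ x, x ∉ Ω → φ x = 0 := fun x hx =>
    image_eq_zero_of_notMem_tsupport (fun hx' => hx (hs hx'))
  have z' : ∀ x, x ∉ Ω → partialDeriv j φ x = 0 := fun x hx => by
    have : x ∉ tsupport (fderiv ℝ φ) := fun hx' => hx (hs (tsupport_fderiv_subset ℝ hx'))
    simp [partialDeriv, image_eq_zero_of_notMem_tsupport this]
  rw [setIntegral_eq_integral_of_forall_compl_eq_zero (by intro x hx; simp [z x hx]),
    setIntegral_eq_integral_of_forall_compl_eq_zero (by intro x hx; simp [z x hx, z' x hx])]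
  have l : ∫ x, ((-(Complex.I * h)) * (partialDeriv j ψ x * φ x)
      - vectorPotential B x j * (ψ x * φ x)) = ∫ x, ((Complex.I * h) * (ψ x * partialDeriv j φ x)
      - vectorPotential B x j * (ψ x * φ x)) := by
    rw [integral_sub (i1.const_mul _) i4, integral_sub (i2.const_mul _) i4, integral_const_mul,
      integral_const_mul, ibp]
    ring
  convert l using 1
  · refine integral_congr_ae (Filter.Eventually.of_forall fun x => ?_)
    simp
    ring
  · refine integral_congr_ae (Filter.Eventually.of_forall fun x => ?_)
    simp
    ring

/-- On an open set the graph is single valued, so that it is the graph of an operator. -/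
lemma magneticNeumannGraph_singleValued (B h : ℝ) {Ω : Set Plane} (hΩ : IsOpen Ω) :
    ∀ p : L2 Ω × L2 Ω, p ∈ magneticNeumannGraph B h Ω → p.1 = 0 → p.2 = 0 := by
  rintro ⟨u, f⟩ ⟨g, hg, hf⟩ (rfl : u = 0)
  have g0 : ∀ j, g j = 0 := fun j => L2_eq_zero_of_test hΩ _ fun ψ h1 h2 h3 => by
    have hψ : ContDiff ℝ ∞ (fun x => (ψ x : ℂ)) := Complex.ofRealCLM.contDiff.comp h1
    have hcψ : HasCompactSupport (fun x => (ψ x : ℂ)) := h2.comp_left Complex.ofReal_zero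
    have hs : tsupport (fun x => (ψ x : ℂ)) ⊆ Ω :=
      (closure_mono fun x hx => by simpa using hx).trans h3
    rw [hg j _ hψ hcψ hs]
    exact (IsMagneticGradient.zero B h Ω j _ hψ hcψ hs).symm.trans
      ((by simpa using integral_smul_mul (Ω := Ω) 0 0 (fun x => (ψ x : ℂ))))
  refine L2_eq_zero_of_test hΩ _ fun ψ h1 h2 h3 => ?_
  have hψ : ContDiff ℝ ∞ (fun x => (ψ x : ℂ)) := Complex.ofRealCLM.contDiff.comp h1
  have hcψ : HasCompactSupport (fun x => (ψ x : ℂ)) := h2.comp_left Complex.ofReal_zero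
  have := hf _ _ (isMagneticGradient_test B h hψ hcψ)
  simp only [g0, inner_zero_right, Finset.sum_const_zero] at this
  rw [this, L2.inner_def]
  refine integral_congr_ae ?_
  filter_upwards [(hψ.continuous.memLp_of_hasCompactSupport hcψ).coeFn_toLp
    (μ := volume.restrict Ω)] with x hx
  rw [hx]
  simp

/-- The magnetic Neumann realization of `(-ih∇ - A)²` on the open set `Ω`, as an unbounded operator
on `L²(Ω)`. -/
noncomputable def magneticNeumannLaplacian (B h : ℝ) (Ω : Set Plane) : L2 Ω →ₗ.[ℂ] L2 Ω :=
  (magneticNeumannGraph B h Ω).toLinearPMap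

/-! The estimate is an Agmon estimate. Two facts drive it. The energies involved lie below `b * h`
with `b = (1 + Θ₀) / 2 * B`, and `Θ₀ < 1` gives `b < B`. A function vanishing near the boundary
extends by zero to the plane, where the magnetic energy is at least the Landau level `h * B`. So low
energy states can live only within distance of order `√h` of the boundary.

The Landau bound (`landau`) comes from the commutator of the two magnetic derivatives, first for
test functions, then by mollification and cutoff for weak gradients. With a cutoff at scale `√h` it
yields `exists_neumann_lower_bound`: the Neumann form dominates `h * B` up to an error of order `h`
carried by the boundary layer. For a weight `f` with `|∂ⱼ f| ≤ κ / √h * f`, the localization formula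
`re_inner_mulL2_eq` turns this into a lower bound for `Re ⟨f v, f T v⟩`, with gap `B - 2 κ² - b >
0`.

For an eigenfunction this would conclude at once. A spectral subspace may be infinite dimensional,
and `T v` is no multiple of `v`. The abstract lemma `norm_sq_le_of_agmon` replaces the eigenvalue
equation: it needs only that `T` preserves the subspace and is bounded there by `b * h`, and its
constant does not depend on the bounded weight. These properties of `T` are extracted from the
scalar spectral measures. The weights then increase to `exp (κ t)`, with `t` a smoothed distance in
units of `√h`, and Fatou's lemma concludes. The disks matter only through the openness of the
domain. -/

open Filter Topology
open scoped Convolution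

/-! ### Spectral subspaces, from the scalar spectral measures -/

namespace SpectralResolution

variable {H : Type*} [NormedAddCommGroup H] [InnerProductSpace ℂ H] [CompleteSpace H]

lemma proj_empty_apply (E : SpectralResolution H) (x : H) : E.proj ∅ x = 0 := by
  have h := E.hasSum_iUnion (fun _ => ∅) (fun _ => MeasurableSet.empty)
    (fun _ _ _ => by simp [Function.onFun]) x
  exact tendsto_nhds_unique tendsto_const_nhds h.summable.tendsto_atTop_zero

lemma proj_proj (E : SpectralResolution H) {S T : Set ℝ} (hS : MeasurableSet S)
    (hT : MeasurableSet T) (x : H) : E.proj S (E.proj T x) = E.proj (S ∩ T) x := by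
  rw [E.proj_inter S T hS hT]; rfl

lemma inner_proj_left (E : SpectralResolution H) {S : Set ℝ} (hS : MeasurableSet S) (x y : H) :
    inner ℂ (E.proj S x) y = inner ℂ x (E.proj S y) := by
  have hp := E.isStarProjection S hS
  rw [← ContinuousLinearMap.adjoint_inner_right, ← ContinuousLinearMap.star_eq_adjoint,
    hp.isSelfAdjoint.star_eq]

lemma scalarMeasure_apply (E : SpectralResolution H) (x : H) {S : Set ℝ} (hS : MeasurableSet S) :
    E.scalarMeasure x S = ENNReal.ofReal (‖E.proj S x‖ ^ 2) := by
  rw [scalarMeasure, Measure.ofMeasurable_apply _ hS, E.inner_proj_eq x hS]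

instance (E : SpectralResolution H) (x : H) : IsFiniteMeasure (E.scalarMeasure x) :=
  ⟨by rw [E.scalarMeasure_apply x MeasurableSet.univ]; exact ENNReal.ofReal_lt_top⟩

lemma scalarMeasure_real_univ (E : SpectralResolution H) (x : H) :
    (E.scalarMeasure x).real univ = ‖x‖ ^ 2 := by
  rw [measureReal_def, E.scalarMeasure_apply x MeasurableSet.univ, E.proj_univ,
    ENNReal.toReal_ofReal (by positivity)]
  rfl

lemma proj_eq_zero_of_disjoint (E : SpectralResolution H) {S T : Set ℝ} (hS : MeasurableSet S)
    (hT : MeasurableSet T) (hd : Disjoint S T) {x : H} (hx : E.proj S x = x) :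
    E.proj T x = 0 := by
  rw [← hx, E.proj_proj hT hS, inter_comm, hd.inter_eq, E.proj_empty_apply]

lemma ae_mem_of_proj_eq (E : SpectralResolution H) {S : Set ℝ} (hS : MeasurableSet S) {x : H}
    (hx : E.proj S x = x) : ∀ᵐ t ∂E.scalarMeasure x, t ∈ S := by
  rw [ae_iff]
  change E.scalarMeasure x Sᶜ = 0
  rw [E.scalarMeasure_apply x hS.compl,
    E.proj_eq_zero_of_disjoint hS hS.compl disjoint_compl_right hx]
  simp

lemma proj_compl_eq (E : SpectralResolution H) {S : Set ℝ} (hS : MeasurableSet S) {x : H}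
    (hx : E.proj Sᶜ x = 0) : E.proj S x = x := by
  -- Additivity is available for sequences only, so the partition into `S` and its complement is
  -- padded with empty sets.
  have h := E.hasSum_iUnion (fun n : ℕ => if n = 0 then S else if n = 1 then Sᶜ else ∅)
    (fun n => by
      split_ifs
      exacts [hS, hS.compl, MeasurableSet.empty])
    (fun i j hij => by
      simp only [Function.onFun]
      split_ifs <;> first | (exfalso; omega) | simp [disjoint_compl_right, disjoint_compl_left]) x
  have hU : (⋃ n : ℕ, if n = 0 then S else if n = 1 then Sᶜ else ∅) = univ := by
    refine eq_univ_of_forall fun t => mem_iUnion.2 ?_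
    by_cases ht : t ∈ S
    · exact ⟨0, by simpa using ht⟩
    · exact ⟨1, by simpa using ht⟩
  rw [hU, E.proj_univ] at h
  have h2 := hasSum_single (f := fun n : ℕ =>
    (E.proj (if n = 0 then S else if n = 1 then Sᶜ else ∅)) x) 0 (fun n hn => by
      simp only [hn, if_false]
      split_ifs
      exacts [hx, E.proj_empty_apply x])
  simpa using h2.unique h

/-- A vector is killed by `E(S)` as soon as it is killed by the pieces of a partition of `S`. -/
lemma proj_iUnion_eq_zero (E : SpectralResolution H) {S : ℕ → Set ℝ}
    (hS : ∀ n, MeasurableSet (S n)) (hd : Pairwise (Function.onFun Disjoint S)) {x : H}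
    (hx : ∀ n, E.proj (S n) x = 0) : E.proj (⋃ n, S n) x = 0 := by
  have h := E.hasSum_iUnion S hS hd x
  simp only [hx] at h
  exact h.unique hasSum_zero

/-- On a bounded set `t ^ 2` is bounded and the scalar measure is finite. This is why half-lines are
cut into unit intervals below. -/
lemma IsResolutionOf.mem_domain {E : SpectralResolution H} {T : H →ₗ.[ℂ] H}
    (hE : E.IsResolutionOf T) {S : Set ℝ} (hS : MeasurableSet S) {C : ℝ} (hC : ∀ t ∈ S, |t| ≤ C)
    {x : H} (hx : E.proj S x = x) : x ∈ T.domain := by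
  rw [hE.1]
  refine Integrable.of_bound (by fun_prop) (C ^ 2) ?_
  filter_upwards [E.ae_mem_of_proj_eq hS hx] with t ht
  rw [Real.norm_of_nonneg (by positivity)]
  exact sq_le_sq' (by linarith [neg_abs_le t, hC t ht]) ((le_abs_self t).trans (hC t ht))

lemma IsResolutionOf.integrable_id {E : SpectralResolution H} {T : H →ₗ.[ℂ] H}
    (hE : E.IsResolutionOf T) {x : H} (hx : x ∈ T.domain) :
    Integrable (fun t : ℝ => t) (E.scalarMeasure x) := by
  refine (((hE.1 x).1 hx).add (integrable_const (1 : ℝ))).mono (by fun_prop) ?_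
  refine Filter.Eventually.of_forall fun t => ?_
  rw [Real.norm_eq_abs, Real.norm_eq_abs]
  refine le_trans ?_ (le_abs_self _)
  simp only [Pi.add_apply]
  nlinarith [sq_abs t, sq_nonneg (|t| - 1)]

/-- The cross term `⟨E(A) x, E(A) y⟩` factors through `E(S ∩ A ∩ T) = 0`. -/
lemma scalarMeasure_add (E : SpectralResolution H) {S T : Set ℝ} (hS : MeasurableSet S)
    (hT : MeasurableSet T) (hd : Disjoint S T) {x y : H} (hx : E.proj S x = x)
    (hy : E.proj T y = y) :
    E.scalarMeasure (x + y) = E.scalarMeasure x + E.scalarMeasure y := by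
  ext A hA
  rw [Measure.add_apply, E.scalarMeasure_apply _ hA, E.scalarMeasure_apply _ hA,
    E.scalarMeasure_apply _ hA, ← ENNReal.ofReal_add (by positivity) (by positivity), map_add]
  congr 1
  have h0 : inner ℂ (E.proj A x) (E.proj A y) = 0 := by
    rw [E.inner_proj_left hA, E.proj_proj hA hA, inter_self, ← hx, E.inner_proj_left hS,
      ← hy, E.proj_proj hA hT, E.proj_proj hS (hA.inter hT)]
    have : S ∩ (A ∩ T) = ∅ := by
      rw [inter_left_comm, hd.inter_eq, inter_empty]
    rw [this, E.proj_empty_apply, inner_zero_right]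
  simpa [sq] using norm_add_sq_eq_norm_sq_add_norm_sq_of_inner_eq_zero _ _ h0

/-- The resolution prescribes `T` only through its quadratic form. That form is additive on `x + y`
because the scalar measures add, so the two cross terms cancel. -/
lemma IsResolutionOf.inner_add_inner {E : SpectralResolution H} {T : H →ₗ.[ℂ] H}
    (hE : E.IsResolutionOf T) {S S' : Set ℝ} (hS : MeasurableSet S) (hS' : MeasurableSet S')
    (hd : Disjoint S S') (x y : T.domain) (hx : E.proj S x = x) (hy : E.proj S' y = y) :
    inner ℂ (x : H) (T y) + inner ℂ (y : H) (T x) = 0 := by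
  have h := hE.2 (x + y)
  rw [Submodule.coe_add, E.scalarMeasure_add hS hS' hd hx hy,
    integral_add_measure (hE.integrable_id x.2) (hE.integrable_id y.2), LinearPMap.map_add,
    inner_add_left, inner_add_right, inner_add_right, Complex.ofReal_add, ← hE.2 x, ← hE.2 y] at h
  linear_combination h

/-- Spectral subspaces of disjoint sets are not coupled by the operator. -/
lemma IsResolutionOf.inner_apply_eq_zero {E : SpectralResolution H} {T : H →ₗ.[ℂ] H}
    (hE : E.IsResolutionOf T) {S S' : Set ℝ} (hS : MeasurableSet S) (hS' : MeasurableSet S')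
    (hd : Disjoint S S') (x y : T.domain) (hx : E.proj S x = x) (hy : E.proj S' y = y) :
    inner ℂ (x : H) (T y) = 0 := by
  have h1 := hE.inner_add_inner hS hS' hd x y hx hy
  -- Replacing `x` by `i x` changes the relative sign of the two cross terms, so each of them
  -- vanishes; symmetry of `T` is not needed.
  have h2 := hE.inner_add_inner hS hS' hd (Complex.I • x) y
    (by rw [Submodule.coe_smul, map_smul, hx]) hy
  rw [LinearPMap.map_smul, Submodule.coe_smul, inner_smul_left, inner_smul_right,
    Complex.conj_I] at h2
  have h3 : (2 * Complex.I) * inner ℂ (x : H) (T y) = 0 := by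
    linear_combination Complex.I * h1 - h2
  simpa using h3

lemma disjoint_Ico_neg (m n : ℕ) (h : m ≠ n) :
    Disjoint (Ico (-((m : ℝ) + 1)) (-m)) (Ico (-((n : ℝ) + 1)) (-n)) := by
  rw [Set.disjoint_left]
  rintro t ⟨h1, h2⟩ ⟨h3, h4⟩
  rcases lt_or_gt_of_ne h with h | h
  · have : (m : ℝ) + 1 ≤ n := by exact_mod_cast h
    linarith
  · have : (n : ℝ) + 1 ≤ m := by exact_mod_cast h
    linarith

lemma disjoint_Ioc_nat (a : ℝ) (m n : ℕ) (h : m ≠ n) :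
    Disjoint (Ioc (a + m) (a + m + 1)) (Ioc (a + n) (a + n + 1)) := by
  rw [Set.disjoint_left]
  rintro t ⟨h1, h2⟩ ⟨h3, h4⟩
  rcases lt_or_gt_of_ne h with h | h
  · have : (m : ℝ) + 1 ≤ n := by exact_mod_cast h
    linarith
  · have : (n : ℝ) + 1 ≤ m := by exact_mod_cast h
    linarith

lemma iUnion_Ico_neg : (⋃ n : ℕ, Ico (-((n : ℝ) + 1)) (-n)) = Iio 0 := by
  ext t
  simp only [mem_iUnion, mem_Ico, mem_Iio]
  constructor
  · rintro ⟨n, -, h⟩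
    have : (0 : ℝ) ≤ n := n.cast_nonneg
    linarith
  · intro ht
    have h1 : 0 < ⌈-t⌉₊ := Nat.ceil_pos.2 (by linarith)
    have h2 := Nat.ceil_lt_add_one (a := -t) (by linarith)
    have h3 := Nat.le_ceil (-t)
    obtain ⟨k, hk⟩ : ∃ k, ⌈-t⌉₊ = k + 1 := ⟨⌈-t⌉₊ - 1, by omega⟩
    rw [hk] at h2 h3
    push_cast at h2 h3
    exact ⟨k, by linarith, by linarith⟩

lemma iUnion_Ioc_nat (a : ℝ) : (⋃ n : ℕ, Ioc (a + n) (a + n + 1)) = Ioi a := by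
  ext t
  simp only [mem_iUnion, mem_Ioc, mem_Ioi]
  constructor
  · rintro ⟨n, h, -⟩
    have : (0 : ℝ) ≤ n := n.cast_nonneg
    linarith
  · intro ht
    have h1 : 0 < ⌈t - a⌉₊ := Nat.ceil_pos.2 (by linarith)
    have h2 := Nat.ceil_lt_add_one (a := t - a) (by linarith)
    have h3 := Nat.le_ceil (t - a)
    obtain ⟨k, hk⟩ : ∃ k, ⌈t - a⌉₊ = k + 1 := ⟨⌈t - a⌉₊ - 1, by omega⟩
    rw [hk] at h2 h3
    push_cast at h2 h3
    exact ⟨k, by linarith, by linarith⟩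

/-- A nonnegative operator has no negative spectrum. -/
lemma IsResolutionOf.proj_Iio_zero {E : SpectralResolution H} {T : H →ₗ.[ℂ] H}
    (hE : E.IsResolutionOf T) (hT : ∀ x : T.domain, 0 ≤ (inner ℂ (x : H) (T x)).re) (x : H) :
    E.proj (Iio 0) x = 0 := by
  rw [← iUnion_Ico_neg]
  refine E.proj_iUnion_eq_zero (fun n => measurableSet_Ico)
    (fun m n hmn => disjoint_Ico_neg m n hmn) fun n => ?_
  set S : Set ℝ := Ico (-((n : ℝ) + 1)) (-n)
  have hS : MeasurableSet S := measurableSet_Ico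
  set y := E.proj S x
  have hy : E.proj S y = y := by rw [E.proj_proj hS hS, inter_self]
  have hn : (0 : ℝ) ≤ n := n.cast_nonneg
  have hneg : ∀ᵐ t ∂E.scalarMeasure y, t < 0 := by
    filter_upwards [E.ae_mem_of_proj_eq hS hy] with t ht
    linarith [ht.2]
  have hdom : y ∈ T.domain := hE.mem_domain hS (C := n + 1)
    (fun t ht => abs_le.2 ⟨ht.1, by linarith [ht.2]⟩) hy
  have h1 := hT ⟨y, hdom⟩
  rw [hE.2 ⟨y, hdom⟩, Complex.ofReal_re] at h1
  -- The scalar measure of `y` lives on negative `t`, yet its first moment is nonnegative. The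
  -- measure, and with it `y`, must vanish.
  have h2 : ∫ t, -t ∂E.scalarMeasure y ≤ 0 := by
    rw [integral_neg]; exact neg_nonpos.2 h1
  have h3 : 0 ≤ᵐ[E.scalarMeasure y] fun t => -t := by
    filter_upwards [hneg] with t ht
    exact (neg_pos.2 ht).le
  have h4 := (integral_eq_zero_iff_of_nonneg_ae h3 (hE.integrable_id hdom).neg).1
    (le_antisymm h2 (integral_nonneg_of_ae h3))
  have h5 : ∀ᵐ t ∂E.scalarMeasure y, False := by
    filter_upwards [hneg, h4] with t ht ht'
    simp only [Pi.zero_apply] at ht'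
    linarith
  have h6 : E.scalarMeasure y = 0 := by simpa [ae_iff] using h5
  have h7 := E.scalarMeasure_real_univ y
  rw [h6] at h7
  simpa using h7.symm

lemma IsResolutionOf.ae_mem_Icc {E : SpectralResolution H} {T : H →ₗ.[ℂ] H}
    (hE : E.IsResolutionOf T) (hT : ∀ x : T.domain, 0 ≤ (inner ℂ (x : H) (T x)).re) {a : ℝ} {x : H}
    (hx : E.proj (Iic a) x = x) : E.proj (Icc 0 a) x = x := by
  have h0 : E.proj (Ici 0) x = x := E.proj_compl_eq measurableSet_Ici (by
    rw [compl_Ici]; exact hE.proj_Iio_zero hT x)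
  rw [← Ici_inter_Iic, ← E.proj_proj measurableSet_Ici measurableSet_Iic, hx, h0]

/-- The half-line is unbounded below; nonnegativity reduces it to the bounded interval `Icc 0 a`. -/
lemma IsResolutionOf.mem_domain_of_Iic {E : SpectralResolution H} {T : H →ₗ.[ℂ] H}
    (hE : E.IsResolutionOf T) (hT : ∀ x : T.domain, 0 ≤ (inner ℂ (x : H) (T x)).re) {a : ℝ} {x : H}
    (hx : E.proj (Iic a) x = x) : x ∈ T.domain :=
  hE.mem_domain measurableSet_Icc (C := |a|)
    (fun t ht => by rw [abs_of_nonneg ht.1]; exact ht.2.trans (le_abs_self a))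
    (hE.ae_mem_Icc hT hx)

lemma IsResolutionOf.inner_le_of_Iic {E : SpectralResolution H} {T : H →ₗ.[ℂ] H}
    (hE : E.IsResolutionOf T) {a : ℝ} (x : T.domain)
    (hx : E.proj (Iic a) x = x) : (inner ℂ (x : H) (T x)).re ≤ a * ‖(x : H)‖ ^ 2 := by
  rw [hE.2 x, Complex.ofReal_re, ← E.scalarMeasure_real_univ (x : H)]
  have h := integral_mono_ae (hE.integrable_id x.2) (integrable_const a)
    (E.ae_mem_of_proj_eq measurableSet_Iic hx)
  simpa [mul_comm] using h

/-- For a bounded slice `S` above `a`, the vector `z = E(S) T x` is in the domain and is decoupled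
from `x`, so `⟨z, T x⟩ = 0`. But this inner product is `‖z‖²`. -/
lemma IsResolutionOf.proj_Iic_apply {E : SpectralResolution H} {T : H →ₗ.[ℂ] H}
    (hE : E.IsResolutionOf T) {a : ℝ} (x : T.domain)
    (hx : E.proj (Iic a) x = x) : E.proj (Iic a) (T x) = T x := by
  refine E.proj_compl_eq measurableSet_Iic ?_
  rw [compl_Iic, ← iUnion_Ioc_nat]
  refine E.proj_iUnion_eq_zero (fun n => measurableSet_Ioc)
    (fun m n hmn => disjoint_Ioc_nat a m n hmn) fun n => ?_
  set S : Set ℝ := Ioc (a + n) (a + n + 1)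
  have hS : MeasurableSet S := measurableSet_Ioc
  have hn : (0 : ℝ) ≤ n := n.cast_nonneg
  set z := E.proj S (T x) with hz
  have hzz : E.proj S z = z := by rw [E.proj_proj hS hS, inter_self]
  have hdom : z ∈ T.domain := hE.mem_domain hS (C := |a| + n + 1)
    (fun t ht => abs_le.2 ⟨by linarith [ht.1, neg_abs_le a], by linarith [ht.2, le_abs_self a]⟩) hzz
  have h := hE.inner_apply_eq_zero hS measurableSet_Iic (by
    rw [Set.disjoint_left]
    intro t ht ht'
    have h1 := ht.1
    have h2 : t ≤ a := ht'
    linarith) ⟨z, hdom⟩ x hzz hx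
  change inner ℂ z (T x) = 0 at h
  rw [← hzz, E.inner_proj_left hS, ← hz, inner_self_eq_zero] at h
  exact h

end SpectralResolution

/-! ### An abstract Agmon lemma on an invariant subspace -/

/-- Let `A` preserve `K` with `A ≤ a` in the form sense and `‖A‖ ≤ a` there. If `Y` is a bounded
weight satisfying the Agmon inequality with `l > a`, then the norm of `Y` on `K` is controlled. -/
lemma norm_sq_le_of_agmon {H : Type*} [NormedAddCommGroup H] [InnerProductSpace ℂ H]
    (K : Submodule ℂ H) (A : H → H) (Y : H →L[ℂ] H) {a l c : ℝ} (ha : 0 ≤ a) (hal : a < l)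
    (hc : 0 ≤ c) (hAK : ∀ v ∈ K, A v ∈ K) (hA : ∀ v ∈ K, ‖A v‖ ≤ a * ‖v‖)
    (hAv : ∀ v ∈ K, (inner ℂ v (A v)).re ≤ a * ‖v‖ ^ 2)
    (hY : ∀ v ∈ K, l * ‖Y v‖ ^ 2 - c * ‖v‖ ^ 2 ≤ (inner ℂ (Y v) (Y (A v))).re) {v : H}
    (hv : v ∈ K) : ‖Y v‖ ^ 2 ≤ c / (l - a) * ‖v‖ ^ 2 := by
  -- Boundedness of `Y` serves only to make some constant admissible. `S` is closed, so the best
  -- constant `M` is attained. Requiring `0 ≤ m` keeps `S` bounded below even when `K` is trivial.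
  set S : Set ℝ := {m | 0 ≤ m ∧ ∀ v ∈ K, ‖Y v‖ ^ 2 ≤ m * ‖v‖ ^ 2} with hS
  have hne : S.Nonempty := ⟨‖Y‖ ^ 2, by positivity, fun v _ => by
    rw [← mul_pow]; exact pow_le_pow_left₀ (norm_nonneg _) (Y.le_opNorm v) 2⟩
  have hbd : BddBelow S := ⟨0, fun m hm => hm.1⟩
  have hcl : IsClosed S := by
    have : S = Ici 0 ∩ ⋂ v ∈ K, {m : ℝ | ‖Y v‖ ^ 2 ≤ m * ‖v‖ ^ 2} := by
      ext m; simp [hS]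
    rw [this]
    exact isClosed_Ici.inter (isClosed_biInter fun v _ =>
      isClosed_le continuous_const (continuous_id.mul continuous_const))
  set M := sInf S with hM
  obtain ⟨hM0, hMK⟩ : M ∈ S := hcl.csInf_mem hne hbd
  set L := l + a
  -- One explicit Euler step of the flow of `-(l - A)`, which stays in `K`: with `y = (l - A) v`,
  -- the squared norm of `v - t y` is at most `1 - 2 t (l - a) + t² L²` times that of `v`, while `‖Y
  -- (v - t y)‖²` is at least `‖Y v‖² - 2 t c ‖v‖²`. Applying `M` to `v - t y` gives a new
  -- admissible constant for `v`. Minimality of `M` and division by `t` give the claim.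
  have key : ∀ t : ℝ, 0 < t → t ≤ 1 / (2 * (l - a)) →
      0 ≤ -2 * M * (l - a) + t * (M * L ^ 2) + 2 * c := by
    intro t ht ht1
    -- The upper bound on `t` only keeps the new constant nonnegative, as membership in `S` demands.
    have hlt : 2 * t * (l - a) ≤ 1 := by
      rw [le_div_iff₀ (by linarith)] at ht1; linarith
    have hmem : M * (1 - 2 * t * (l - a) + t ^ 2 * L ^ 2) + 2 * t * c ∈ S := by
      refine ⟨?_, fun v hv => ?_⟩
      · have : 0 ≤ 1 - 2 * t * (l - a) + t ^ 2 * L ^ 2 := by nlinarith [sq_nonneg (t * L)]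
        positivity
      · set y : H := (l : ℂ) • v - A v with hy
        have hyK : v - (t : ℂ) • y ∈ K :=
          K.sub_mem hv (K.smul_mem _ (K.sub_mem (K.smul_mem _ hv) (hAK v hv)))
        have h1 := hMK _ hyK
        have hyn : ‖y‖ ≤ L * ‖v‖ := by
          calc ‖y‖ ≤ ‖(l : ℂ) • v‖ + ‖A v‖ := norm_sub_le _ _
            _ ≤ l * ‖v‖ + a * ‖v‖ := by
              rw [norm_smul, Complex.norm_real, Real.norm_of_nonneg (by linarith)]
              linarith [hA v hv]
            _ = L * ‖v‖ := by ring
        have hyn2 : ‖y‖ ^ 2 ≤ L ^ 2 * ‖v‖ ^ 2 := by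
          rw [← mul_pow]; exact pow_le_pow_left₀ (norm_nonneg _) hyn 2
        have e1 : ‖v - (t : ℂ) • y‖ ^ 2 =
            ‖v‖ ^ 2 - 2 * t * (l * ‖v‖ ^ 2 - (inner ℂ v (A v)).re) + t ^ 2 * ‖y‖ ^ 2 := by
          rw [@norm_sub_sq ℂ, inner_smul_right, norm_smul, Complex.norm_real, mul_pow,
            Real.norm_eq_abs, sq_abs, hy,
            inner_sub_right, inner_smul_right, inner_self_eq_norm_sq_to_K]
          simp [← Complex.ofReal_pow]
          ring
        have e2 : ‖Y (v - (t : ℂ) • y)‖ ^ 2 = ‖Y v‖ ^ 2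
            - 2 * t * (l * ‖Y v‖ ^ 2 - (inner ℂ (Y v) (Y (A v))).re) + t ^ 2 * ‖Y y‖ ^ 2 := by
          rw [map_sub, map_smul, @norm_sub_sq ℂ, inner_smul_right, norm_smul, Complex.norm_real,
            mul_pow, Real.norm_eq_abs, sq_abs, hy, map_sub, map_smul, inner_sub_right,
            inner_smul_right, inner_self_eq_norm_sq_to_K]
          simp [← Complex.ofReal_pow]
          ring
        rw [e1, e2] at h1
        have h2 := hY v hv
        have h3 := hAv v hv
        have h4 : 0 ≤ t ^ 2 * ‖Y y‖ ^ 2 := by positivity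
        have h5 : t * (l * ‖Y v‖ ^ 2 - (inner ℂ (Y v) (Y (A v))).re) ≤ t * (c * ‖v‖ ^ 2) :=
          mul_le_mul_of_nonneg_left (by linarith) ht.le
        have h6 : M * (t * (a * ‖v‖ ^ 2 - (inner ℂ v (A v)).re)) ≥ 0 :=
          mul_nonneg hM0 (mul_nonneg ht.le (by linarith))
        have h7 : M * t ^ 2 * ‖y‖ ^ 2 ≤ M * t ^ 2 * (L ^ 2 * ‖v‖ ^ 2) :=
          mul_le_mul_of_nonneg_left hyn2 (by positivity)
        nlinarith
    have h := csInf_le hbd hmem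
    rw [← hM] at h
    have : 0 ≤ t * (-2 * M * (l - a) + t * (M * L ^ 2) + 2 * c) := by linarith
    exact nonneg_of_mul_nonneg_right this ht
  have hlim : M * (l - a) ≤ c := by
    by_contra hcon
    push Not at hcon
    have hpos : 0 < l - a := by linarith
    set d := M * (l - a) - c with hd
    have hd0 : 0 < d := by linarith
    have hW : 0 < M * L ^ 2 + 1 := by positivity
    -- With this `t` the quadratic term is at most `d`, so `key` reads `0 ≤ -2 d + d`, a
    -- contradiction.
    have hW' := key (min (1 / (2 * (l - a))) (d / (M * L ^ 2 + 1)))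
      (lt_min (by positivity) (by positivity)) (min_le_left _ _)
    have : min (1 / (2 * (l - a))) (d / (M * L ^ 2 + 1)) * (M * L ^ 2) ≤ d := by
      calc _ ≤ d / (M * L ^ 2 + 1) * (M * L ^ 2 + 1) :=
            mul_le_mul (min_le_right _ _) (by linarith) (by positivity) (by positivity)
        _ = d := by field_simp
    linarith
  refine (hMK v hv).trans (mul_le_mul_of_nonneg_right ?_ (by positivity))
  rw [le_div_iff₀ (by linarith)]
  exact hlim

/-! ### Magnetic derivatives of smooth functions and the Landau level -/

/-- The classical derivative `(-ih∂_j - A_j) f`. -/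
noncomputable def magneticDeriv (B h : ℝ) (j : Fin 2) (f : Plane → ℂ) (x : Plane) : ℂ :=
  -(Complex.I * h) * partialDeriv j f x - vectorPotential B x j * f x

lemma partialDeriv_contDiff (j : Fin 2) {f : Plane → ℂ} (hf : ContDiff ℝ ∞ f) :
    ContDiff ℝ ∞ (partialDeriv j f) :=
  (hf.fderiv_right (m := ∞) (by simp)).clm_apply contDiff_const

lemma partialDeriv_hasCompactSupport (j : Fin 2) {f : Plane → ℂ} (hc : HasCompactSupport f) :
    HasCompactSupport (partialDeriv j f) :=
  HasCompactSupport.fderiv_apply (𝕜 := ℝ) hc (EuclideanSpace.single j (1 : ℝ))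

lemma vectorPotential_contDiff (B : ℝ) (j : Fin 2) :
    ContDiff ℝ ∞ fun x : Plane => (vectorPotential B x j : ℂ) := by
  refine Complex.ofRealCLM.contDiff.comp ?_
  fin_cases j
  · change ContDiff ℝ ∞ fun x : Plane => -(B / 2) * x 1
    fun_prop
  · change ContDiff ℝ ∞ fun x : Plane => B / 2 * x 0
    fun_prop

lemma magneticDeriv_contDiff (B h : ℝ) (j : Fin 2) {f : Plane → ℂ} (hf : ContDiff ℝ ∞ f) :
    ContDiff ℝ ∞ (magneticDeriv B h j f) :=
  (contDiff_const.mul (partialDeriv_contDiff j hf)).sub ((vectorPotential_contDiff B j).mul hf)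

lemma magneticDeriv_hasCompactSupport (B h : ℝ) (j : Fin 2) {f : Plane → ℂ}
    (hc : HasCompactSupport f) : HasCompactSupport (magneticDeriv B h j f) :=
  ((partialDeriv_hasCompactSupport j hc).mul_left (f := fun _ => -(Complex.I * h))).sub
    hc.mul_left

lemma partialDeriv_conj (j : Fin 2) {f : Plane → ℂ} (hf : ContDiff ℝ ∞ f) (x : Plane) :
    partialDeriv j (fun y => (starRingEnd ℂ) (f y)) x = (starRingEnd ℂ) (partialDeriv j f x) := by
  have h := (Complex.conjCLE.toContinuousLinearMap.hasFDerivAt.comp x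
    (hf.differentiable (by simp) x).hasFDerivAt).fderiv
  have h' : fderiv ℝ (fun y => (starRingEnd ℂ) (f y)) x =
    Complex.conjCLE.toContinuousLinearMap.comp (fderiv ℝ f x) := h
  rw [partialDeriv, h']
  rfl

/-- The magnetic derivatives are symmetric. -/
lemma integral_conj_magneticDeriv_mul (B h : ℝ) (j : Fin 2) {f k : Plane → ℂ}
    (hf : ContDiff ℝ ∞ f) (hk : ContDiff ℝ ∞ k) (hc : HasCompactSupport k) :
    ∫ x, (starRingEnd ℂ) (magneticDeriv B h j f x) * k x =
      ∫ x, (starRingEnd ℂ) (f x) * magneticDeriv B h j k x := by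
  have hf' : ContDiff ℝ ∞ (fun y => (starRingEnd ℂ) (f y)) :=
    Complex.conjCLE.contDiff.comp hf
  have c1 : Continuous (fun y => (starRingEnd ℂ) (f y)) := hf'.continuous
  have cA := (vectorPotential_contDiff B j).continuous
  have i1 : Integrable (fun x => partialDeriv j (fun y => (starRingEnd ℂ) (f y)) x * k x)
      (volume : Measure Plane) :=
    ((partialDeriv_contDiff j hf').continuous.mul hk.continuous).integrable_of_hasCompactSupport
      hc.mul_left
  have i2 : Integrable (fun x => (starRingEnd ℂ) (f x) * partialDeriv j k x)
      (volume : Measure Plane) :=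
    (c1.mul (partialDeriv_contDiff j hk).continuous).integrable_of_hasCompactSupport
      (partialDeriv_hasCompactSupport j hc).mul_left
  have i3 : Integrable (fun x => (starRingEnd ℂ) (f x) * k x) (volume : Measure Plane) :=
    (c1.mul hk.continuous).integrable_of_hasCompactSupport hc.mul_left
  have i4 : Integrable (fun x => (vectorPotential B x j : ℂ) * ((starRingEnd ℂ) (f x) * k x))
      (volume : Measure Plane) :=
    (cA.mul (c1.mul hk.continuous)).integrable_of_hasCompactSupport hc.mul_left.mul_left
  have ibp : ∫ x, (starRingEnd ℂ) (f x) * partialDeriv j k x =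
      - ∫ x, partialDeriv j (fun y => (starRingEnd ℂ) (f y)) x * k x :=
    integral_mul_fderiv_eq_neg_fderiv_mul_of_integrable i1 i2 i3
      (fun x _ => hf'.differentiable (by simp) x) (fun x _ => hk.differentiable (by simp) x)
  have e1 : (fun x => (starRingEnd ℂ) (magneticDeriv B h j f x) * k x) =
      fun x => (Complex.I * h) * (partialDeriv j (fun y => (starRingEnd ℂ) (f y)) x * k x) -
        (vectorPotential B x j : ℂ) * ((starRingEnd ℂ) (f x) * k x) := by
    ext x
    simp only [magneticDeriv, partialDeriv_conj j hf, map_sub, map_mul, map_neg, Complex.conj_I,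
      Complex.conj_ofReal]
    ring
  have e2 : (fun x => (starRingEnd ℂ) (f x) * magneticDeriv B h j k x) =
      fun x => (-(Complex.I * h)) * ((starRingEnd ℂ) (f x) * partialDeriv j k x) -
        (vectorPotential B x j : ℂ) * ((starRingEnd ℂ) (f x) * k x) := by
    ext x
    simp only [magneticDeriv]
    ring
  rw [e1, e2, integral_sub (i1.const_mul _) i4, integral_sub (i2.const_mul _) i4,
    integral_const_mul, integral_const_mul, ibp]
  ring

lemma partialDeriv_comm (i j : Fin 2) {f : Plane → ℂ} (hf : ContDiff ℝ ∞ f) (x : Plane) :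
    partialDeriv i (partialDeriv j f) x = partialDeriv j (partialDeriv i f) x := by
  have hd : DifferentiableAt ℝ (fderiv ℝ f) x :=
    (hf.fderiv_right (m := ∞) (by simp)).differentiable (by simp) x
  have key : ∀ v w : Plane, fderiv ℝ (fun y => fderiv ℝ f y v) x w =
      fderiv ℝ (fderiv ℝ f) x w v := by
    intro v w
    rw [fderiv_clm_apply hd (differentiableAt_const v)]
    simp
  have hs : IsSymmSndFDerivAt ℝ f x := hf.contDiffAt.isSymmSndFDerivAt (by
    rw [minSmoothness_of_isRCLikeNormedField]; exact WithTop.coe_le_coe.2 (le_top : (2 : ℕ∞) ≤ ⊤))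
  change fderiv ℝ (fun y => fderiv ℝ f y _) x _ = fderiv ℝ (fun y => fderiv ℝ f y _) x _
  rw [key, key, hs.eq]

lemma partialDeriv_vectorPotential (B : ℝ) (x : Plane) :
    partialDeriv 0 (fun x => (vectorPotential B x 1 : ℂ)) x = B / 2 ∧
    partialDeriv 1 (fun x => (vectorPotential B x 0 : ℂ)) x = -(B / 2) := by
  constructor
  · have : (fun x : Plane => (vectorPotential B x 1 : ℂ)) =
        Complex.ofRealCLM.comp ((B / 2) • EuclideanSpace.proj (𝕜 := ℝ) (0 : Fin 2)) := by
      ext x; simp [vectorPotential]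
    rw [partialDeriv, this, ContinuousLinearMap.fderiv]
    simp
  · have : (fun x : Plane => (vectorPotential B x 0 : ℂ)) =
        Complex.ofRealCLM.comp ((-(B / 2)) • EuclideanSpace.proj (𝕜 := ℝ) (1 : Fin 2)) := by
      ext x; simp [vectorPotential]
    rw [partialDeriv, this, ContinuousLinearMap.fderiv]
    simp

lemma partialDeriv_mul (j : Fin 2) {f k : Plane → ℂ} {x : Plane} (hf : DifferentiableAt ℝ f x)
    (hk : DifferentiableAt ℝ k x) : partialDeriv j (fun y => f y * k y) x =
      partialDeriv j f x * k x + f x * partialDeriv j k x := by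
  simp only [partialDeriv]
  rw [fderiv_fun_mul hf hk]
  simp
  ring

lemma partialDeriv_magneticDeriv (B h : ℝ) (i j : Fin 2) {f : Plane → ℂ} (hf : ContDiff ℝ ∞ f)
    (x : Plane) : partialDeriv i (magneticDeriv B h j f) x =
      -(Complex.I * h) * partialDeriv i (partialDeriv j f) x -
        (partialDeriv i (fun x => (vectorPotential B x j : ℂ)) x * f x +
          vectorPotential B x j * partialDeriv i f x) := by
  have d1 := (partialDeriv_contDiff j hf).differentiable (by simp) x
  have d2 := (vectorPotential_contDiff B j).differentiable (by simp) x
  have d3 := hf.differentiable (by simp) x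
  rw [← partialDeriv_mul i d2 d3]
  simp only [partialDeriv]
  have : magneticDeriv B h j f = fun x => -(Complex.I * h) * partialDeriv j f x -
    (vectorPotential B x j : ℂ) * f x := rfl
  rw [this, ((d1.hasFDerivAt.const_mul (-(Complex.I * h))).fun_sub (d2.fun_mul d3).hasFDerivAt).fderiv]
  rfl

/-- Second derivatives of `f` cancel by symmetry, first order terms cancel pairwise, and the curl of
the potential, which is `B`, remains. -/
lemma magneticDeriv_commutator (B h : ℝ) {f : Plane → ℂ} (hf : ContDiff ℝ ∞ f) (x : Plane) :
    magneticDeriv B h 0 (magneticDeriv B h 1 f) x - magneticDeriv B h 1 (magneticDeriv B h 0 f) x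
      = Complex.I * h * B * f x := by
  have e0 := partialDeriv_magneticDeriv B h 0 1 hf x
  have e1 := partialDeriv_magneticDeriv B h 1 0 hf x
  have c := partialDeriv_comm 0 1 hf x
  obtain ⟨a0, a1⟩ := partialDeriv_vectorPotential B x
  rw [a0] at e0
  rw [a1] at e1
  rw [magneticDeriv, e0, magneticDeriv, magneticDeriv, e1, c, magneticDeriv]
  ring

lemma eLpNorm_two_sq {α E : Type*} [MeasurableSpace α] [NormedAddCommGroup E] (μ : Measure α)
    (f : α → E) : eLpNorm f 2 μ ^ 2 = ∫⁻ x, ‖f x‖ₑ ^ 2 ∂μ := by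
  have h := eLpNorm_nnreal_pow_eq_lintegral (f := f) (μ := μ) (p := 2) (by norm_num)
  simpa using h

lemma eLpNorm_two_sq_eq_ofReal {α E : Type*} [MeasurableSpace α] [NormedAddCommGroup E]
    {μ : Measure α} {f : α → E} (hf : MemLp f 2 μ) :
    eLpNorm f 2 μ ^ 2 = ENNReal.ofReal (∫ x, ‖f x‖ ^ 2 ∂μ) := by
  rw [eLpNorm_two_sq, ofReal_integral_eq_lintegral_ofReal ((memLp_two_iff_integrable_sq_norm hf.1).1 hf)
    (Eventually.of_forall fun x => by positivity)]
  refine lintegral_congr fun x => ?_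
  rw [ENNReal.ofReal_pow (norm_nonneg _), ofReal_norm]

/-- The Landau lower bound for test functions. -/
lemma landau_smooth (B h : ℝ) {f : Plane → ℂ} (hf : ContDiff ℝ ∞ f) (hc : HasCompactSupport f) :
    ENNReal.ofReal (h * B) * eLpNorm f 2 volume ^ 2 ≤
      ∑ j, eLpNorm (magneticDeriv B h j f) 2 volume ^ 2 := by
  set a := magneticDeriv B h 0 f with ha
  set b := magneticDeriv B h 1 f with hb
  have sa : ContDiff ℝ ∞ a := magneticDeriv_contDiff B h 0 hf
  have sb : ContDiff ℝ ∞ b := magneticDeriv_contDiff B h 1 hf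
  have ca : HasCompactSupport a := magneticDeriv_hasCompactSupport B h 0 hc
  have cb : HasCompactSupport b := magneticDeriv_hasCompactSupport B h 1 hc
  have ma : MemLp a 2 (volume : Measure Plane) := sa.continuous.memLp_of_hasCompactSupport ca
  have mb : MemLp b 2 (volume : Measure Plane) := sb.continuous.memLp_of_hasCompactSupport cb
  have mf : MemLp f 2 (volume : Measure Plane) := hf.continuous.memLp_of_hasCompactSupport hc
  have ia := (memLp_two_iff_integrable_sq_norm ma.1).1 ma
  have ib := (memLp_two_iff_integrable_sq_norm mb.1).1 mb
  have i1 : Integrable (fun x => (starRingEnd ℂ) (a x) * b x) (volume : Measure Plane) :=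
    ((Complex.continuous_conj.comp sa.continuous).mul sb.continuous).integrable_of_hasCompactSupport
      cb.mul_left
  have i2 : Integrable (fun x => (starRingEnd ℂ) (b x) * a x) (volume : Measure Plane) :=
    ((Complex.continuous_conj.comp sb.continuous).mul sa.continuous).integrable_of_hasCompactSupport
      ca.mul_left
  -- Moving both derivatives off the conjugated factors turns the difference into `⟨f, [P₀, P₁] f⟩`,
  -- where the commutator is the scalar `i h B`.
  have hcomm : ∫ x, ((starRingEnd ℂ) (a x) * b x - (starRingEnd ℂ) (b x) * a x) =
      Complex.I * ((h * B * ∫ x, ‖f x‖ ^ 2 : ℝ) : ℂ) := by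
    have c2 : HasCompactSupport (magneticDeriv B h 0 b) :=
      magneticDeriv_hasCompactSupport B h 0 cb
    have c3 : HasCompactSupport (magneticDeriv B h 1 a) :=
      magneticDeriv_hasCompactSupport B h 1 ca
    have i3 : Integrable (fun x => (starRingEnd ℂ) (f x) * magneticDeriv B h 0 b x)
        (volume : Measure Plane) :=
      ((Complex.continuous_conj.comp hf.continuous).mul
        (magneticDeriv_contDiff B h 0 sb).continuous).integrable_of_hasCompactSupport c2.mul_left
    have i4 : Integrable (fun x => (starRingEnd ℂ) (f x) * magneticDeriv B h 1 a x)
        (volume : Measure Plane) :=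
      ((Complex.continuous_conj.comp hf.continuous).mul
        (magneticDeriv_contDiff B h 1 sa).continuous).integrable_of_hasCompactSupport c3.mul_left
    rw [integral_sub i1 i2, integral_conj_magneticDeriv_mul B h 0 hf sb cb,
      integral_conj_magneticDeriv_mul B h 1 hf sa ca, ← integral_sub i3 i4,
      ← integral_const_mul, ← integral_complex_ofReal, ← integral_const_mul]
    refine integral_congr_ae (Eventually.of_forall fun x => ?_)
    dsimp only
    rw [← mul_sub, magneticDeriv_commutator B h hf x]
    have := Complex.conj_mul' (f x)
    push_cast
    linear_combination (Complex.I * h * B) * this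
  have him : ∀ x, (starRingEnd ℂ) (a x) * b x - (starRingEnd ℂ) (b x) * a x =
      ((2 * ((starRingEnd ℂ) (a x) * b x).im : ℝ) : ℂ) * Complex.I := by
    intro x
    apply Complex.ext <;> simp <;> ring
  have hint : ∫ x, 2 * ((starRingEnd ℂ) (a x) * b x).im = h * B * ∫ x, ‖f x‖ ^ 2 := by
    simp_rw [him] at hcomm
    rw [integral_mul_const, integral_complex_ofReal, mul_comm] at hcomm
    have := mul_left_cancel₀ Complex.I_ne_zero hcomm
    exact_mod_cast this
  -- The difference of the two sides is `|a + i b|²`.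
  have hpt : ∀ x, 2 * ((starRingEnd ℂ) (a x) * b x).im ≤ ‖a x‖ ^ 2 + ‖b x‖ ^ 2 := by
    intro x
    rw [← Complex.normSq_eq_norm_sq, ← Complex.normSq_eq_norm_sq, Complex.normSq_apply,
      Complex.normSq_apply]
    simp
    nlinarith [sq_nonneg ((a x).re - (b x).im), sq_nonneg ((a x).im + (b x).re)]
  have hfin : h * B * ∫ x, ‖f x‖ ^ 2 ≤ (∫ x, ‖a x‖ ^ 2) + ∫ x, ‖b x‖ ^ 2 := by
    rw [← hint, ← integral_add ia ib]
    exact integral_mono (i1.im.const_mul 2) (ia.add ib) hpt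
  rw [Fin.sum_univ_two, eLpNorm_two_sq_eq_ofReal mf, eLpNorm_two_sq_eq_ofReal ma,
    eLpNorm_two_sq_eq_ofReal mb, ← ENNReal.ofReal_add (by positivity) (by positivity),
    ← ENNReal.ofReal_mul' (by positivity)]
  exact ENNReal.ofReal_le_ofReal hfin

/-! ### The Landau bound for weak magnetic gradients on the plane -/

/-- Young's inequality in `L²` for a probability density. -/
lemma eLpNorm_two_le_of_le_average {ρ : Plane → ℝ} (hρ : Continuous ρ)
    (h1 : ∫⁻ y, ENNReal.ofReal (ρ y) = 1) {f k : Plane → ℂ} (c : ℝ≥0∞)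
    (hf : AEStronglyMeasurable f volume)
    (hk : ∀ x, ‖k x‖ₑ ≤ c * ∫⁻ y, ENNReal.ofReal (ρ (x - y)) * ‖f y‖ₑ) :
    eLpNorm k 2 volume ≤ c * eLpNorm f 2 volume := by
  have hw : Measurable fun y => ENNReal.ofReal (ρ y) := hρ.measurable.ennreal_ofReal
  -- Jensen's inequality for the probability measure with density `ρ (x - y)`; Tonelli and
  -- translation invariance then remove `ρ`.
  have hsq : ∀ x, (∫⁻ y, ENNReal.ofReal (ρ (x - y)) * ‖f y‖ₑ) ^ 2 ≤
      ∫⁻ y, ENNReal.ofReal (ρ (x - y)) * ‖f y‖ₑ ^ 2 := by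
    intro x
    have hwx : Measurable fun y => ENNReal.ofReal (ρ (x - y)) :=
      hw.comp (measurable_const.sub measurable_id)
    set ν := (volume : Measure Plane).withDensity fun y => ENNReal.ofReal (ρ (x - y))
    have hν : IsProbabilityMeasure ν := ⟨by
      rw [withDensity_apply _ MeasurableSet.univ, Measure.restrict_univ,
        lintegral_sub_left_eq_self (fun y => ENNReal.ofReal (ρ y)) x, h1]⟩
    have hac : ν ≪ volume := withDensity_absolutelyContinuous _ _
    have h := eLpNorm_le_eLpNorm_of_exponent_le (p := 1) (q := 2) (by norm_num) (hf.mono_ac hac)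
    have h' := pow_le_pow_left' h 2
    rw [eLpNorm_two_sq, eLpNorm_one_eq_lintegral_enorm,
      lintegral_withDensity_eq_lintegral_mul₀ hwx.aemeasurable hf.enorm,
      lintegral_withDensity_eq_lintegral_mul₀ hwx.aemeasurable (hf.enorm.pow_const 2)] at h'
    exact h'
  have hm : AEMeasurable (Function.uncurry fun x y : Plane =>
      ENNReal.ofReal (ρ (x - y)) * ‖f y‖ₑ ^ 2) (volume.prod volume) := by
    have e1 : Measurable fun p : Plane × Plane => ENNReal.ofReal (ρ (p.1 - p.2)) :=
      hw.comp (measurable_fst.sub measurable_snd)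
    exact e1.aemeasurable.mul ((hf.enorm.pow_const 2).comp_snd)
  have hfin : ∫⁻ x, (∫⁻ y, ENNReal.ofReal (ρ (x - y)) * ‖f y‖ₑ ^ 2) = ∫⁻ y, ‖f y‖ₑ ^ 2 := by
    rw [lintegral_lintegral_swap hm]
    refine lintegral_congr fun y => ?_
    have hwy : Measurable fun x : Plane => ENNReal.ofReal (ρ (x - y)) :=
      hw.comp (measurable_id.sub measurable_const)
    rw [lintegral_mul_const _ hwy,
      lintegral_sub_right_eq_self (fun y => ENNReal.ofReal (ρ y)) y, h1, one_mul]
  have hm2 : AEMeasurable (fun x : Plane => ∫⁻ y, ENNReal.ofReal (ρ (x - y)) * ‖f y‖ₑ ^ 2) :=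
    hm.lintegral_prod_right'
  have key : eLpNorm k 2 volume ^ 2 ≤ (c * eLpNorm f 2 volume) ^ 2 := by
    rw [mul_pow, eLpNorm_two_sq, eLpNorm_two_sq, ← hfin, ← lintegral_const_mul'' _ hm2]
    refine lintegral_mono fun x => ?_
    calc ‖k x‖ₑ ^ 2 ≤ (c * ∫⁻ y, ENNReal.ofReal (ρ (x - y)) * ‖f y‖ₑ) ^ 2 :=
          pow_le_pow_left' (hk x) 2
      _ ≤ _ := by rw [mul_pow]; gcongr; exact hsq x
  exact (ENNReal.pow_le_pow_left_iff two_ne_zero).1 key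

/-- `g = (-ih∇ - A) F` in the sense of distributions on the plane. -/
def IsPlaneMagneticGradient (B h : ℝ) (F : Plane → ℂ) (g : Fin 2 → Plane → ℂ) : Prop :=
  ∀ (j : Fin 2) (φ : Plane → ℂ), ContDiff ℝ ∞ φ → HasCompactSupport φ →
    ∫ x, g j x * φ x = ∫ x, F x * (Complex.I * h * partialDeriv j φ x - vectorPotential B x j * φ x)

/-- Product rule for weak magnetic derivatives, tested against `φ`. -/
lemma integral_magnetic_mul (μ : Measure Plane) [IsFiniteMeasureOnCompacts μ] (B h : ℝ) (j : Fin 2)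
    {F g : Plane → ℂ} (hF : MemLp F 2 μ) (hg : MemLp g 2 μ) {ψ φ : Plane → ℂ}
    (hψ : ContDiff ℝ ∞ ψ) (hφ : ContDiff ℝ ∞ φ) (hc : HasCompactSupport φ)
    (hw : ∫ x, g x * (ψ x * φ x) ∂μ = ∫ x, F x * (Complex.I * h *
      partialDeriv j (fun y => ψ y * φ y) x - vectorPotential B x j * (ψ x * φ x)) ∂μ) :
    ∫ x, (ψ x * g x - Complex.I * h * partialDeriv j ψ x * F x) * φ x ∂μ =
      ∫ x, (ψ x * F x) * (Complex.I * h * partialDeriv j φ x - vectorPotential B x j * φ x) ∂μ := by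
  have hψφ : ContDiff ℝ ∞ fun y => ψ y * φ y := hψ.mul hφ
  have hcψφ : HasCompactSupport fun y => ψ y * φ y := hc.mul_left
  have i1 : Integrable (fun x => g x * (ψ x * φ x)) μ :=
    hg.integrable_mul (hψφ.continuous.memLp_of_hasCompactSupport (p := 2) hcψφ)
  have i2 : Integrable (fun x => F x * (Complex.I * h * (partialDeriv j ψ x * φ x))) μ := by
    refine hF.integrable_mul (Continuous.memLp_of_hasCompactSupport (p := 2) ?_ ?_)
    · exact continuous_const.mul ((partialDeriv_contDiff j hψ).continuous.mul hφ.continuous)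
    · exact hc.mul_left.mul_left
  have i3 : Integrable (fun x => F x * (Complex.I * h *
      partialDeriv j (fun y => ψ y * φ y) x - vectorPotential B x j * (ψ x * φ x))) μ :=
    hF.integrable_mul (magneticTest_memLp μ B h j hψφ hcψφ)
  have e1 : (fun x => (ψ x * g x - Complex.I * h * partialDeriv j ψ x * F x) * φ x) =
      fun x => g x * (ψ x * φ x) - F x * (Complex.I * h * (partialDeriv j ψ x * φ x)) := by
    ext x; ring
  -- The weak equation enters only through the test function `ψ φ`. The lemma thus serves on the
  -- plane, and on a domain whenever either factor is supported inside it.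
  rw [e1, integral_sub i1 i2, hw, ← integral_sub i3 i2]
  refine integral_congr_ae (Eventually.of_forall fun x => ?_)
  dsimp only
  rw [partialDeriv_mul j (hψ.differentiable (by simp) x) (hφ.differentiable (by simp) x)]
  ring

lemma IsPlaneMagneticGradient.mul {B h : ℝ} {F : Plane → ℂ} {g : Fin 2 → Plane → ℂ}
    (hw : IsPlaneMagneticGradient B h F g) (hF : MemLp F 2 volume) (hg : ∀ j, MemLp (g j) 2 volume)
    {ψ : Plane → ℂ} (hψ : ContDiff ℝ ∞ ψ) :
    IsPlaneMagneticGradient B h (fun x => ψ x * F x)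
      (fun j x => ψ x * g j x - Complex.I * h * partialDeriv j ψ x * F x) :=
  fun j _ hφ hc => integral_magnetic_mul volume B h j hF (hg j) hψ hφ hc
    (hw j _ (hψ.mul hφ) hc.mul_left)

lemma abs_vectorPotential_sub_le (B : ℝ) (j : Fin 2) (x y : Plane) :
    |vectorPotential B y j - vectorPotential B x j| ≤ |B| / 2 * ‖x - y‖ := by
  have hc : ∀ i, |x i - y i| ≤ ‖x - y‖ := fun i => by
    simpa using PiLp.norm_apply_le (x - y) i
  fin_cases j
  · change |-(B / 2) * y 1 - -(B / 2) * x 1| ≤ _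
    rw [show -(B / 2) * y 1 - -(B / 2) * x 1 = B / 2 * (x 1 - y 1) by ring, abs_mul, abs_div]
    simpa using mul_le_mul_of_nonneg_left (hc 1) (by positivity : 0 ≤ |B| / 2)
  · change |B / 2 * y 0 - B / 2 * x 0| ≤ _
    rw [show B / 2 * y 0 - B / 2 * x 0 = -(B / 2 * (x 0 - y 0)) by ring, abs_neg, abs_mul, abs_div]
    simpa using mul_le_mul_of_nonneg_left (hc 0) (by positivity : 0 ≤ |B| / 2)

section Mollify

variable (φ : ContDiffBump (0 : Plane))

/-- Mollification by a bump function. -/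
noncomputable def mollify (F : Plane → ℂ) : Plane → ℂ :=
  φ.normed volume ⋆[ContinuousLinearMap.lsmul ℝ ℝ, volume] F

lemma mollify_apply (F : Plane → ℂ) (x : Plane) :
    mollify φ F x = ∫ y, (φ.normed volume (x - y) : ℂ) * F y := by
  rw [mollify, convolution_eq_swap]
  simp

lemma lintegral_normed : ∫⁻ y, ENNReal.ofReal (φ.normed (volume : Measure Plane) y) = 1 := by
  rw [← ofReal_integral_eq_lintegral_ofReal φ.integrable_normed
    (Eventually.of_forall fun y => φ.nonneg_normed y), φ.integral_normed, ENNReal.ofReal_one]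

lemma mollify_contDiff {F : Plane → ℂ} (hF : MemLp F 2 volume) : ContDiff ℝ ∞ (mollify φ F) :=
  φ.hasCompactSupport_normed.contDiff_convolution_left _ (n := ⊤) φ.contDiff_normed
    (hF.locallyIntegrable (by norm_num))

lemma mollify_hasCompactSupport {F : Plane → ℂ} (hF : HasCompactSupport F) :
    HasCompactSupport (mollify φ F) :=
  φ.hasCompactSupport_normed.convolution _ hF

lemma partialDeriv_mollify {F : Plane → ℂ} (hF : MemLp F 2 volume) (j : Fin 2) (x : Plane) :
    partialDeriv j (mollify φ F) x =
      ∫ y, (fderiv ℝ (φ.normed volume) (x - y) (EuclideanSpace.single j 1) : ℂ) * F y := by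
  have hl := hF.locallyIntegrable (by norm_num)
  have hd := φ.hasCompactSupport_normed.hasFDerivAt_convolution_left
    (ContinuousLinearMap.lsmul ℝ ℝ) (φ.contDiff_normed (n := 1) (μ := volume)) hl x
  rw [partialDeriv]
  have h2 : fderiv ℝ (mollify φ F) x = _ := hd.fderiv
  rw [h2, convolution_eq_swap]
  have hex := (φ.hasCompactSupport_normed.fderiv (𝕜 := ℝ)).convolutionExists_left
    ((ContinuousLinearMap.lsmul ℝ ℝ).precompL Plane)
    ((φ.contDiff_normed (n := 1) (μ := volume)).continuous_fderiv (by simp)) hl x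
  rw [ContinuousLinearMap.integral_apply hex.integrable_swap]
  simp [ContinuousLinearMap.precompL_apply]

lemma contDiff_normed_sub (x : Plane) :
    ContDiff ℝ ∞ fun y => (φ.normed volume (x - y) : ℂ) :=
  Complex.ofRealCLM.contDiff.comp
    ((φ.contDiff_normed (n := ⊤)).comp (contDiff_const.sub contDiff_id))

lemma hasCompactSupport_normed_sub (x : Plane) :
    HasCompactSupport fun y => (φ.normed volume (x - y) : ℂ) :=
  (φ.hasCompactSupport_normed.comp_homeomorph (Homeomorph.subLeft x)).comp_left
    Complex.ofReal_zero

lemma partialDeriv_normed_sub (j : Fin 2) (x y : Plane) :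
    partialDeriv j (fun y => (φ.normed volume (x - y) : ℂ)) y =
      -(fderiv ℝ (φ.normed volume) (x - y) (EuclideanSpace.single j 1) : ℂ) := by
  have h1 : HasFDerivAt (φ.normed volume) (fderiv ℝ (φ.normed volume) (x - y)) (x - y) :=
    ((φ.contDiff_normed (n := ⊤)).differentiable (by simp) _).hasFDerivAt
  have h2 := Complex.ofRealCLM.hasFDerivAt.comp y
    (h1.comp y ((hasFDerivAt_const x y).sub (hasFDerivAt_id y)))
  have h3 : fderiv ℝ (fun y => (φ.normed volume (x - y) : ℂ)) y = _ := h2.fderiv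
  rw [partialDeriv, h3]
  simp

/-- Convolution commutes with the derivative, so the whole error is its commutator with
multiplication by the potential. The weak equation is tested against the kernel `y ↦ φ (x - y)`. -/
lemma magneticDeriv_mollify_sub {B h : ℝ} {F : Plane → ℂ} {g : Fin 2 → Plane → ℂ}
    (hw : IsPlaneMagneticGradient B h F g) (hF : MemLp F 2 volume) (j : Fin 2) (x : Plane) :
    magneticDeriv B h j (mollify φ F) x - mollify φ (g j) x =
      ∫ y, ((vectorPotential B y j - vectorPotential B x j : ℝ) : ℂ) *
        (φ.normed volume (x - y) : ℂ) * F y := by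
  have c1 := contDiff_normed_sub φ x
  have c2 := hasCompactSupport_normed_sub φ x
  have e := hw j _ c1 c2
  have i1 := hF.integrable_mul (magneticTest_memLp volume B h j c1 c2)
  have i2 := hF.integrable_mul (c1.continuous.memLp_of_hasCompactSupport (p := 2) c2)
  have i3 := hF.integrable_mul
    ((partialDeriv_contDiff j c1).continuous.memLp_of_hasCompactSupport (p := 2)
      (partialDeriv_hasCompactSupport j c2))
  have e2 : mollify φ (g j) x = ∫ y, g j y * (φ.normed volume (x - y) : ℂ) := by
    rw [mollify_apply]; simp_rw [mul_comm]
  have e3 : mollify φ F x = ∫ y, F y * (φ.normed volume (x - y) : ℂ) := by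
    rw [mollify_apply]; simp_rw [mul_comm]
  have e4 : partialDeriv j (mollify φ F) x =
      -∫ y, F y * partialDeriv j (fun y => (φ.normed volume (x - y) : ℂ)) y := by
    rw [partialDeriv_mollify φ hF, ← integral_neg]
    refine integral_congr_ae (Eventually.of_forall fun y => ?_)
    dsimp only
    rw [partialDeriv_normed_sub]
    ring
  rw [magneticDeriv, e2, e, e3, e4]
  have s1 := integral_sub ((i3.const_mul (Complex.I * h)).sub
    (i2.const_mul (vectorPotential B x j : ℂ))) i1
  have s2 := integral_sub (i3.const_mul (Complex.I * h)) (i2.const_mul (vectorPotential B x j : ℂ))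
  have s3 : -(Complex.I * h) *
      (-∫ y, F y * partialDeriv j (fun y => (φ.normed volume (x - y) : ℂ)) y) -
      (vectorPotential B x j : ℂ) * (∫ y, F y * (φ.normed volume (x - y) : ℂ)) =
      (∫ y, Complex.I * h * (F y * partialDeriv j (fun y => (φ.normed volume (x - y) : ℂ)) y)) -
      ∫ y, (vectorPotential B x j : ℂ) * (F y * (φ.normed volume (x - y) : ℂ)) := by
    rw [integral_const_mul, integral_const_mul]; ring
  rw [s3]
  refine (congrArg (· - _) s2.symm).trans (s1.symm.trans ?_)
  refine integral_congr_ae (Eventually.of_forall fun y => ?_)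
  simp only [Pi.sub_apply, Pi.mul_apply, Complex.ofReal_sub]
  ring

lemma eLpNorm_mollify_le {F : Plane → ℂ} (hF : MemLp F 2 volume) :
    eLpNorm (mollify φ F) 2 volume ≤ eLpNorm F 2 volume := by
  have h := eLpNorm_two_le_of_le_average φ.continuous_normed (lintegral_normed φ) (k := mollify φ F) 1 hF.1
    (fun x => by
      rw [mollify_apply, one_mul]
      refine (enorm_integral_le_lintegral_enorm _).trans_eq (lintegral_congr fun y => ?_)
      rw [enorm_mul, ← ofReal_norm (φ.normed volume (x - y) : ℂ), Complex.norm_real,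
        Real.norm_of_nonneg (φ.nonneg_normed _)])
  rwa [one_mul] at h

/-- The potential is linear, so over the support of the kernel it varies by at most `|B| / 2` times
the radius, uniformly in `x`. This makes the commutator small in `L²` although the potential is
unbounded. -/
lemma eLpNorm_magneticDeriv_mollify_le {B h : ℝ} {F : Plane → ℂ} {g : Fin 2 → Plane → ℂ}
    (hw : IsPlaneMagneticGradient B h F g) (hF : MemLp F 2 volume) (hg : ∀ j, MemLp (g j) 2 volume)
    (j : Fin 2) :
    eLpNorm (magneticDeriv B h j (mollify φ F)) 2 volume ≤
      eLpNorm (g j) 2 volume + ENNReal.ofReal (|B| / 2 * φ.rOut) * eLpNorm F 2 volume := by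
  set r : Plane → ℂ := fun x => magneticDeriv B h j (mollify φ F) x - mollify φ (g j) x with hr
  have c1 := (magneticDeriv_contDiff B h j (mollify_contDiff φ hF)).continuous
  have c2 := (mollify_contDiff φ (hg j)).continuous
  have hsum : magneticDeriv B h j (mollify φ F) = mollify φ (g j) + r := by
    ext x; simp [hr]
  have hrb : eLpNorm r 2 volume ≤ ENNReal.ofReal (|B| / 2 * φ.rOut) * eLpNorm F 2 volume := by
    refine eLpNorm_two_le_of_le_average φ.continuous_normed (lintegral_normed φ) _ hF.1 fun x => ?_
    rw [hr]
    dsimp only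
    rw [magneticDeriv_mollify_sub φ hw hF, ← lintegral_const_mul' _ _ ENNReal.ofReal_ne_top]
    refine (enorm_integral_le_lintegral_enorm _).trans (lintegral_mono fun y => ?_)
    rw [enorm_mul, ← mul_assoc]
    gcongr
    rw [← ofReal_norm, ← ENNReal.ofReal_mul (by have := φ.rOut_pos; positivity)]
    refine ENNReal.ofReal_le_ofReal ?_
    rw [norm_mul, Complex.norm_real, Complex.norm_real, Real.norm_of_nonneg (φ.nonneg_normed _)]
    by_cases hy : φ.normed volume (x - y) = 0
    · simp [hy]
    · have hs : x - y ∈ Function.support (φ.normed volume) := hy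
      rw [φ.support_normed_eq, mem_ball_zero_iff] at hs
      refine mul_le_mul_of_nonneg_right ?_ (φ.nonneg_normed _)
      exact (abs_vectorPotential_sub_le B j x y).trans
        (mul_le_mul_of_nonneg_left hs.le (by positivity))
  calc eLpNorm (magneticDeriv B h j (mollify φ F)) 2 volume
      ≤ eLpNorm (mollify φ (g j)) 2 volume + eLpNorm r 2 volume := by
        rw [hsum]
        exact eLpNorm_add_le c2.aestronglyMeasurable (c1.sub c2).aestronglyMeasurable (by norm_num)
    _ ≤ _ := add_le_add (eLpNorm_mollify_le φ (hg j)) hrb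

end Mollify

/-- The Landau bound passes to the limit under almost everywhere convergence. -/
lemma landau_of_tendsto {c : ℝ} (hc : 0 < c) {F : Plane → ℂ} {g : Fin 2 → Plane → ℂ}
    (hF : MemLp F 2 volume) (Fn : ℕ → Plane → ℂ)
    (gn : ℕ → Fin 2 → Plane → ℂ) (e : ℕ → ℝ) (he : Tendsto e atTop (𝓝 0))
    (hm : ∀ n, AEStronglyMeasurable (Fn n) volume)
    (hl : ∀ᵐ x ∂(volume : Measure Plane), Tendsto (fun n => Fn n x) atTop (𝓝 (F x)))
    (hb : ∀ n, ENNReal.ofReal c * eLpNorm (Fn n) 2 volume ^ 2 ≤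
      ∑ j, eLpNorm (gn n j) 2 volume ^ 2)
    (hgn : ∀ n j, eLpNorm (gn n j) 2 volume ≤
      eLpNorm (g j) 2 volume + ENNReal.ofReal (e n) * eLpNorm F 2 volume) :
    ENNReal.ofReal c * eLpNorm F 2 volume ^ 2 ≤ ∑ j, eLpNorm (g j) 2 volume ^ 2 := by
  have hc0 : ENNReal.ofReal c ≠ 0 := by simpa using hc
  -- Only the lower bound for the norms of `Fn` is needed in the limit, so almost everywhere
  -- convergence and Fatou suffice.
  have hFatou := lintegral_liminf_le' (μ := (volume : Measure Plane)) (u := atTop)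
    (f := fun n x => ‖Fn n x‖ₑ ^ 2) fun n => (hm n).enorm.pow_const 2
  have hlim : ∫⁻ x, liminf (fun n => ‖Fn n x‖ₑ ^ 2) atTop = ∫⁻ x, ‖F x‖ₑ ^ 2 := by
    refine lintegral_congr_ae ?_
    filter_upwards [hl] with x hx
    exact (((ENNReal.continuous_pow 2).tendsto _).comp hx.enorm).liminf_eq
  rw [hlim, ← eLpNorm_two_sq] at hFatou
  simp_rw [← eLpNorm_two_sq] at hFatou
  have hR : Tendsto (fun n => (∑ j, (eLpNorm (g j) 2 volume +
      ENNReal.ofReal (e n) * eLpNorm F 2 volume) ^ 2) / ENNReal.ofReal c) atTop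
      (𝓝 ((∑ j, eLpNorm (g j) 2 volume ^ 2) / ENNReal.ofReal c)) := by
    refine ENNReal.Tendsto.div_const (tendsto_finsetSum _ fun j _ => ?_) (Or.inr hc0)
    have h1 : Tendsto (fun n => ENNReal.ofReal (e n) * eLpNorm F 2 volume) atTop (𝓝 0) := by
      have := ENNReal.Tendsto.mul_const (b := eLpNorm F 2 volume)
        (ENNReal.tendsto_ofReal he) (Or.inr hF.2.ne)
      simpa using this
    have h2 := ((ENNReal.continuous_pow 2).tendsto _).comp
      (tendsto_const_nhds (x := eLpNorm (g j) 2 volume).add h1)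
    simpa [Function.comp_def] using h2
  have hle : ∀ n, eLpNorm (Fn n) 2 volume ^ 2 ≤ (∑ j, (eLpNorm (g j) 2 volume +
      ENNReal.ofReal (e n) * eLpNorm F 2 volume) ^ 2) / ENNReal.ofReal c := by
    intro n
    rw [ENNReal.le_div_iff_mul_le (Or.inl hc0) (Or.inl ENNReal.ofReal_ne_top), mul_comm]
    exact (hb n).trans (Finset.sum_le_sum fun j _ => pow_le_pow_left' (hgn n j) 2)
  have := hFatou.trans ((liminf_le_liminf (Eventually.of_forall hle)).trans_eq hR.liminf_eq)
  rwa [ENNReal.le_div_iff_mul_le (Or.inl hc0) (Or.inl ENNReal.ofReal_ne_top), mul_comm] at this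

lemma landau_of_hasCompactSupport {B h : ℝ} (hB : 0 < B) (hh : 0 < h) {F : Plane → ℂ}
    {g : Fin 2 → Plane → ℂ} (hF : MemLp F 2 volume) (hg : ∀ j, MemLp (g j) 2 volume)
    (hw : IsPlaneMagneticGradient B h F g) (hc : HasCompactSupport F) :
    ENNReal.ofReal (h * B) * eLpNorm F 2 volume ^ 2 ≤ ∑ j, eLpNorm (g j) 2 volume ^ 2 := by
  set φ : ℕ → ContDiffBump (0 : Plane) := fun n =>
    ⟨1 / ((n : ℝ) + 1), 2 * (1 / ((n : ℝ) + 1)), by positivity, by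
      have : 0 < 1 / ((n : ℝ) + 1) := by positivity
      linarith⟩ with hφ
  have hr : Tendsto (fun n => (φ n).rOut) atTop (𝓝 0) := by
    have := (tendsto_one_div_add_atTop_nhds_zero_nat (𝕜 := ℝ)).const_mul 2
    simpa [hφ] using this
  -- The fixed ratio 2 of the radii is what convergence at almost every point requires of the
  -- kernels.
  have hae := ContDiffBump.ae_convolution_tendsto_right_of_locallyIntegrable (K := 2)
    (μ := (volume : Measure Plane)) hr
    (Eventually.of_forall fun n => le_rfl) (hF.locallyIntegrable (by norm_num))
  refine landau_of_tendsto (by positivity) hF (fun n => mollify (φ n) F)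
    (fun n j => magneticDeriv B h j (mollify (φ n) F)) (fun n => |B| / 2 * (φ n).rOut)
    (by simpa using hr.const_mul (|B| / 2))
    (fun n => (mollify_contDiff (φ n) hF).continuous.aestronglyMeasurable) hae
    (fun n => landau_smooth B h (mollify_contDiff (φ n) hF) (mollify_hasCompactSupport (φ n) hc))
    (fun n j => eLpNorm_magneticDeriv_mollify_le (φ n) hw hF hg j)

lemma memLp_mul_of_bound {μ : Measure Plane} {f F : Plane → ℂ} (hf : Continuous f) {C : ℝ}
    (hC : ∀ x, ‖f x‖ ≤ C) (hF : MemLp F 2 μ) : MemLp (fun x => f x * F x) 2 μ :=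
  hF.of_le_mul (hf.aestronglyMeasurable.mul hF.1) (c := C)
    (Eventually.of_forall fun x => by
      rw [norm_mul]; exact mul_le_mul_of_nonneg_right (hC x) (norm_nonneg _))

/-- The Landau bound for square integrable functions with a square integrable weak magnetic
gradient on the whole plane. -/
lemma landau {B h : ℝ} (hB : 0 < B) (hh : 0 < h) {F : Plane → ℂ}
    {g : Fin 2 → Plane → ℂ} (hF : MemLp F 2 volume) (hg : ∀ j, MemLp (g j) 2 volume)
    (hw : IsPlaneMagneticGradient B h F g) :
    ENNReal.ofReal (h * B) * eLpNorm F 2 volume ^ 2 ≤ ∑ j, eLpNorm (g j) 2 volume ^ 2 := by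
  set χ : ContDiffBump (0 : Plane) := ⟨1, 2, one_pos, one_lt_two⟩
  set X : Plane → ℂ := fun x => (χ x : ℂ) with hX
  have sX : ContDiff ℝ ∞ X := Complex.ofRealCLM.contDiff.comp χ.contDiff
  have cX : HasCompactSupport X := χ.hasCompactSupport.comp_left Complex.ofReal_zero
  have hb : ∀ j : Fin 2, ∃ C, ∀ x, ‖partialDeriv j X x‖ ≤ C := fun j =>
    (partialDeriv_hasCompactSupport j cX).exists_bound_of_continuous
      (partialDeriv_contDiff j sX).continuous
  choose C hC using hb
  have hC0 : ∀ j, 0 ≤ C j := fun j => (norm_nonneg _).trans (hC j 0)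
  set a : ℕ → ℝ := fun n => 1 / ((n : ℝ) + 1) with ha
  have ha0 : ∀ n, 0 < a n := fun n => by positivity
  have hat : Tendsto a atTop (𝓝 0) := tendsto_one_div_add_atTop_nhds_zero_nat
  -- Dilated cutoffs restore compact support. Their gradients are of size `a n`, so the commutator
  -- term tends to zero.
  set ψ : ℕ → Plane → ℂ := fun n x => X (a n • x) with hψ
  have sψ : ∀ n, ContDiff ℝ ∞ (ψ n) := fun n => sX.comp (contDiff_const_smul _)
  have cψ : ∀ n, HasCompactSupport (ψ n) := fun n =>
    cX.comp_homeomorph (Homeomorph.smulOfNeZero (a n) (ha0 n).ne')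
  have hψ1 : ∀ n x, ‖ψ n x‖ ≤ 1 := fun n x => by
    rw [hψ, hX]
    dsimp only
    rw [Complex.norm_real, Real.norm_of_nonneg χ.nonneg]
    exact χ.le_one
  have dψ : ∀ n j x, ‖partialDeriv j (ψ n) x‖ ≤ a n * (C 0 + C 1) := by
    intro n j x
    have h1 : HasFDerivAt X (fderiv ℝ X (a n • x)) (a n • x) :=
      (sX.differentiable (by simp) _).hasFDerivAt
    have h2 := (h1.comp x ((hasFDerivAt_id x).const_smul (a n))).fderiv
    have h3 : fderiv ℝ (ψ n) x = (fderiv ℝ X (a n • x)).comp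
      (a n • ContinuousLinearMap.id ℝ Plane) := h2
    have h4 : partialDeriv j (ψ n) x = a n * partialDeriv j X (a n • x) := by
      rw [partialDeriv, h3]; simp [partialDeriv]
    rw [h4, norm_mul, Complex.norm_real, Real.norm_of_nonneg (ha0 n).le]
    refine mul_le_mul_of_nonneg_left ((hC j _).trans ?_) (ha0 n).le
    fin_cases j
    · simpa using hC0 1
    · simpa using hC0 0
  have m1 : ∀ n, MemLp (fun x => ψ n x * F x) 2 volume := fun n =>
    memLp_mul_of_bound (sψ n).continuous (hψ1 n) hF
  have m2 : ∀ n j, MemLp (fun x => ψ n x * g j x) 2 volume := fun n j =>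
    memLp_mul_of_bound (sψ n).continuous (hψ1 n) (hg j)
  have b3 : ∀ n j x, ‖Complex.I * h * partialDeriv j (ψ n) x‖ ≤ h * (a n * (C 0 + C 1)) := by
    intro n j x
    rw [norm_mul, norm_mul, Complex.norm_I, one_mul, Complex.norm_real, Real.norm_of_nonneg hh.le]
    exact mul_le_mul_of_nonneg_left (dψ n j x) hh.le
  have m3 : ∀ n j, MemLp (fun x => Complex.I * h * partialDeriv j (ψ n) x * F x) 2 volume :=
    fun n j => memLp_mul_of_bound
      (continuous_const.mul (partialDeriv_contDiff j (sψ n)).continuous) (b3 n j) hF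
  refine landau_of_tendsto (by positivity) hF (fun n x => ψ n x * F x)
    (fun n j x => ψ n x * g j x - Complex.I * h * partialDeriv j (ψ n) x * F x)
    (fun n => h * (a n * (C 0 + C 1)))
    (by simpa using (hat.mul_const (C 0 + C 1)).const_mul h) (fun n => (m1 n).1)
    (Eventually.of_forall fun x => ?_)
    (fun n => landau_of_hasCompactSupport hB hh (m1 n) (fun j => (m2 n j).sub (m3 n j))
      (hw.mul hF hg (sψ n)) (cψ n).mul_right) (fun n j => ?_)
  · have h1 : Tendsto (fun n => X (a n • x)) atTop (𝓝 (X ((0 : ℝ) • x))) :=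
      (sX.continuous.tendsto _).comp (hat.smul_const x)
    have h2 : X ((0 : ℝ) • x) = 1 := by
      rw [zero_smul, hX]
      simpa using congrArg (fun r : ℝ => (r : ℂ))
        (χ.one_of_mem_closedBall (Metric.mem_closedBall_self χ.rIn_pos.le))
    rw [h2] at h1
    simpa using h1.mul_const (F x)
  · refine (eLpNorm_sub_le (m2 n j).1 (m3 n j).1 (by norm_num)).trans (add_le_add ?_ ?_)
    · refine eLpNorm_mono fun x => ?_
      rw [norm_mul]
      exact mul_le_of_le_one_left (norm_nonneg _) (hψ1 n x)
    · refine eLpNorm_le_mul_eLpNorm_of_ae_le_mul (Eventually.of_forall fun x => ?_) _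
      rw [norm_mul]
      exact mul_le_mul_of_nonneg_right (b3 n j x) (norm_nonneg _)

/-! ### The Landau bound inside a domain, with a boundary layer error -/

/-- The Landau bound on a domain, for functions cut off away from the boundary. -/
lemma landau_cutoff {B h : ℝ} (hB : 0 < B) (hh : 0 < h) {Ω : Set Plane} (hΩ : MeasurableSet Ω)
    {u : L2 Ω} {G : Fin 2 → L2 Ω} (hG : IsMagneticGradient B h Ω u G) {ψ : Plane → ℂ}
    (hψ : ContDiff ℝ ∞ ψ) {C C' : ℝ} (hC : ∀ x, ‖ψ x‖ ≤ C) (hC' : ∀ j x, ‖partialDeriv j ψ x‖ ≤ C')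
    (hs : tsupport ψ ⊆ Ω) :
    h * B * ∫ x in Ω, ‖ψ x * u x‖ ^ 2 ≤
      ∑ j, ∫ x in Ω, ‖ψ x * G j x - Complex.I * h * partialDeriv j ψ x * u x‖ ^ 2 := by
  have m1 : MemLp (fun x => ψ x * u x) 2 (volume.restrict Ω) :=
    memLp_mul_of_bound hψ.continuous hC (Lp.memLp u)
  have m2 : ∀ j, MemLp (fun x => ψ x * G j x - Complex.I * h * partialDeriv j ψ x * u x) 2
      (volume.restrict Ω) := fun j =>
    (memLp_mul_of_bound hψ.continuous hC (Lp.memLp (G j))).sub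
      (memLp_mul_of_bound (C := h * C')
        (continuous_const.mul (partialDeriv_contDiff j hψ).continuous) (fun x => by
          rw [norm_mul, norm_mul, Complex.norm_I, one_mul, Complex.norm_real,
            Real.norm_of_nonneg hh.le]
          exact mul_le_mul_of_nonneg_left (hC' j x) hh.le) (Lp.memLp u))
  have e : ∀ F : Plane → ℂ, ∀ φ : Plane → ℂ,
      ∫ x, Ω.indicator F x * φ x = ∫ x in Ω, F x * φ x := by
    intro F φ
    rw [← integral_indicator hΩ]
    refine integral_congr_ae (Eventually.of_forall fun x => ?_)
    by_cases hx : x ∈ Ω <;> simp [hx]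
  -- Extension by zero creates no boundary term: `ψ φ` is supported in `Ω` for every plane test
  -- function `φ`, so it is admissible for the weak equation of `u`.
  have hw : IsPlaneMagneticGradient B h (Ω.indicator fun x => ψ x * u x)
      (fun j => Ω.indicator fun x => ψ x * G j x - Complex.I * h * partialDeriv j ψ x * u x) := by
    intro j φ hφ hc
    rw [e, e]
    exact integral_magnetic_mul (volume.restrict Ω) B h j (Lp.memLp u) (Lp.memLp (G j)) hψ hφ hc
      (hG j _ (hψ.mul hφ) hc.mul_left ((tsupport_mul_subset_left).trans hs))
  have hL := landau hB hh ((memLp_indicator_iff_restrict hΩ).2 m1)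
    (fun j => (memLp_indicator_iff_restrict hΩ).2 (m2 j)) hw
  simp_rw [eLpNorm_indicator_eq_eLpNorm_restrict hΩ] at hL
  rw [eLpNorm_two_sq_eq_ofReal m1, ← ENNReal.ofReal_mul (by positivity)] at hL
  simp_rw [fun j => eLpNorm_two_sq_eq_ofReal (m2 j)] at hL
  rw [← ENNReal.ofReal_sum_of_nonneg (fun j _ => by positivity)] at hL
  exact (ENNReal.ofReal_le_ofReal_iff (Finset.sum_nonneg fun j _ => by positivity)).1 hL

lemma L2_integrable_norm_sq {Ω : Set Plane} (u : L2 Ω) :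
    IntegrableOn (fun x => ‖u x‖ ^ 2) Ω :=
  (memLp_two_iff_integrable_sq_norm (Lp.memLp u).1).1 (Lp.memLp u)

lemma L2_norm_sq {Ω : Set Plane} (u : L2 Ω) : ‖u‖ ^ 2 = ∫ x in Ω, ‖u x‖ ^ 2 := by
  have h := eLpNorm_two_sq_eq_ofReal (Lp.memLp u)
  rw [Lp.norm_def, ← ENNReal.toReal_pow, h, ENNReal.toReal_ofReal (by positivity)]

lemma exists_lipschitz_smoothTransition : ∃ K : NNReal, LipschitzWith K Real.smoothTransition := by
  have hs : ContDiff ℝ 1 Real.smoothTransition := Real.smoothTransition.contDiff (n := 1)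
  have hcd : Continuous (deriv Real.smoothTransition) := hs.continuous_deriv (by simp)
  obtain ⟨C, hC⟩ := isCompact_Icc.exists_bound_of_continuousOn
    (s := Icc (0 : ℝ) 1) hcd.continuousOn
  have hC0 : 0 ≤ C := (norm_nonneg _).trans (hC 0 ⟨le_rfl, zero_le_one⟩)
  refine ⟨⟨C, hC0⟩, lipschitzWith_of_nnnorm_deriv_le (hs.differentiable (by simp)) fun x => ?_⟩
  change ‖deriv Real.smoothTransition x‖ ≤ C
  by_cases hx : x ∈ Icc (0 : ℝ) 1
  · exact hC x hx
  · rw [mem_Icc, not_and_or, not_le, not_le] at hx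
    have : deriv Real.smoothTransition x = 0 := by
      rcases hx with hx | hx
      · have : Real.smoothTransition =ᶠ[𝓝 x] fun _ => 0 := by
          filter_upwards [gt_mem_nhds hx] with y hy
          exact Real.smoothTransition.zero_of_nonpos hy.le
        rw [this.deriv_eq, deriv_const]
      · have : Real.smoothTransition =ᶠ[𝓝 x] fun _ => 1 := by
          filter_upwards [lt_mem_nhds hx] with y hy
          exact Real.smoothTransition.one_of_one_le hy.le
        rw [this.deriv_eq, deriv_const]
    rw [this, norm_zero]
    exact hC0

/-- The partial derivative of a real function. -/
noncomputable def realPartialDeriv (j : Fin 2) (f : Plane → ℝ) (x : Plane) : ℝ :=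
  fderiv ℝ f x (EuclideanSpace.single j 1)

lemma partialDeriv_ofReal (j : Fin 2) {f : Plane → ℝ} {x : Plane} (hf : DifferentiableAt ℝ f x) :
    partialDeriv j (fun y => (f y : ℂ)) x = realPartialDeriv j f x := by
  have h : fderiv ℝ (fun y => (f y : ℂ)) x = _ :=
    (Complex.ofRealCLM.hasFDerivAt.comp x hf.hasFDerivAt).fderiv
  rw [partialDeriv, h]
  rfl

lemma abs_realPartialDeriv_le (j : Fin 2) {f : Plane → ℝ} {K : NNReal} (hf : LipschitzWith K f)
    (x : Plane) : |realPartialDeriv j f x| ≤ K := by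
  have h := (fderiv ℝ f x).le_opNorm (EuclideanSpace.single j 1)
  rw [PiLp.norm_single, norm_one, mul_one] at h
  exact h.trans (norm_fderiv_le_of_lipschitz ℝ hf)

lemma realPartialDeriv_sin (j : Fin 2) {f : Plane → ℝ} {x : Plane} (hf : DifferentiableAt ℝ f x) :
    realPartialDeriv j (fun y => Real.sin (f y)) x = Real.cos (f x) * realPartialDeriv j f x := by
  rw [realPartialDeriv, hf.hasFDerivAt.sin.fderiv]
  rfl

lemma realPartialDeriv_exp (j : Fin 2) {f : Plane → ℝ} {x : Plane} (hf : DifferentiableAt ℝ f x) :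
    realPartialDeriv j (fun y => Real.exp (f y)) x = Real.exp (f x) * realPartialDeriv j f x := by
  rw [realPartialDeriv, hf.hasFDerivAt.exp.fderiv]
  rfl

/-- Cauchy–Schwarz with `sin² + cos² = 1`. The coefficient of `‖z‖²` is exactly 1, so the Neumann
energy is compared without loss and no second cutoff is needed. -/
lemma norm_sin_sub_cos_sq_le (θ : ℝ) (z w : ℂ) :
    ‖(Real.sin θ : ℂ) * z - (Real.cos θ : ℂ) * w‖ ^ 2 ≤ ‖z‖ ^ 2 + ‖w‖ ^ 2 := by
  have h1 : ‖(Real.sin θ : ℂ) * z - (Real.cos θ : ℂ) * w‖ ≤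
      |Real.sin θ| * ‖z‖ + |Real.cos θ| * ‖w‖ := by
    simpa only [norm_mul, Complex.norm_real, Real.norm_eq_abs] using
      norm_sub_le ((Real.sin θ : ℂ) * z) ((Real.cos θ : ℂ) * w)
  have h2 := pow_le_pow_left₀ (norm_nonneg _) h1 2
  refine h2.trans ?_
  have h3 : |Real.sin θ| ^ 2 + |Real.cos θ| ^ 2 = 1 := by
    rw [sq_abs, sq_abs]; exact Real.sin_sq_add_cos_sq θ
  nlinarith [sq_nonneg (|Real.sin θ| * ‖w‖ - |Real.cos θ| * ‖z‖)]

/-- Away from the boundary, the magnetic Neumann form is bounded below by the Landau level. -/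
lemma exists_neumann_lower_bound {B : ℝ} (hB : 0 < B) : ∃ C > 0, ∀ h : ℝ, 0 < h →
    ∀ (Ω : Set Plane), MeasurableSet Ω → ∀ t : Plane → ℝ, ContDiff ℝ ∞ t →
      LipschitzWith (Real.toNNReal (1 / √h)) t → {x | 3 ≤ t x} ⊆ Ω →
      ∀ (u : L2 Ω) (G : Fin 2 → L2 Ω), IsMagneticGradient B h Ω u G →
        h * B * ‖u‖ ^ 2 ≤ ∑ j, ‖G j‖ ^ 2 +
          h * C * ∫ x in Ω, {x | t x < 4}.indicator (fun x => ‖u x‖ ^ 2) x := by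
  obtain ⟨K, hK⟩ := exists_lipschitz_smoothTransition
  set m : ℝ := Real.pi / 2 * K with hm
  have hm0 : 0 ≤ m := by positivity
  -- `B` pays for the mass removed by the cutoff, `m ^ 2` for its derivative in each of the two
  -- directions.
  refine ⟨B + 2 * m ^ 2, by positivity, fun h hh Ω hΩ t ht htl hts u G hG => ?_⟩
  have hsq : 0 < √h := Real.sqrt_pos.2 hh
  -- As `t` goes from 3 to 4 the angle goes from 0 to `π / 2`. So `sin θ` vanishes for `t ≤ 3` and
  -- is 1 for `t ≥ 4`, where also `cos θ = 0` removes the derivative term.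
  set θ : Plane → ℝ := fun x => Real.pi / 2 * Real.smoothTransition (t x - 3) with hθ
  have sθ : ContDiff ℝ ∞ θ :=
    contDiff_const.mul ((Real.smoothTransition.contDiff (n := ⊤)).comp (ht.sub contDiff_const))
  have lθ : LipschitzWith (Real.toNNReal (m / √h)) θ := by
    refine LipschitzWith.of_dist_le_mul fun x y => ?_
    have e1 := hK.dist_le_mul (t x - 3) (t y - 3)
    have e2 := htl.dist_le_mul x y
    rw [Real.coe_toNNReal _ (by positivity)] at e2 ⊢
    rw [Real.dist_eq] at e1 e2 ⊢
    rw [Real.dist_eq, sub_sub_sub_cancel_right] at e1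
    calc |θ x - θ y| = Real.pi / 2 *
          |Real.smoothTransition (t x - 3) - Real.smoothTransition (t y - 3)| := by
          rw [hθ]; dsimp only
          rw [← mul_sub, abs_mul, abs_of_nonneg (by positivity : 0 ≤ Real.pi / 2)]
      _ ≤ Real.pi / 2 * (K * (1 / √h * dist x y)) := by
          gcongr; exact e1.trans (by gcongr)
      _ = m / √h * dist x y := by rw [hm]; ring
  set ψ : Plane → ℂ := fun x => (Real.sin (θ x) : ℂ) with hψ
  have sψ : ContDiff ℝ ∞ ψ := Complex.ofRealCLM.contDiff.comp sθ.sin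
  have dψ : ∀ j x, partialDeriv j ψ x = Real.cos (θ x) * realPartialDeriv j θ x := by
    intro j x
    have hd := sθ.differentiable (by simp) x
    rw [hψ, partialDeriv_ofReal j hd.sin, realPartialDeriv_sin j hd]
    push_cast; rfl
  have bθ : ∀ j x, |realPartialDeriv j θ x| ≤ m / √h := by
    intro j x
    have := abs_realPartialDeriv_le j lθ x
    rwa [Real.coe_toNNReal _ (by positivity)] at this
  have hC : ∀ x, ‖ψ x‖ ≤ 1 := fun x => by
    rw [hψ]; dsimp only
    rw [Complex.norm_real]; exact Real.abs_sin_le_one _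
  have hC' : ∀ j x, ‖partialDeriv j ψ x‖ ≤ m / √h := by
    intro j x
    rw [dψ, norm_mul, Complex.norm_real, Complex.norm_real, ← one_mul (m / √h)]
    exact mul_le_mul (Real.abs_cos_le_one _) (bθ j x) (norm_nonneg _) zero_le_one
  have hsupp : tsupport ψ ⊆ Ω := by
    refine (closure_minimal ?_ (isClosed_le continuous_const ht.continuous)).trans hts
    intro x hx
    by_contra hcon
    simp only [mem_ofPred_eq, not_le] at hcon
    refine hx ?_
    rw [hψ, hθ]; dsimp only
    rw [Real.smoothTransition.zero_of_nonpos (by linarith)]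
    simp
  have hfar : ∀ x, 4 ≤ t x → θ x = Real.pi / 2 := by
    intro x hx
    rw [hθ]; dsimp only
    rw [Real.smoothTransition.one_of_one_le (by linarith), mul_one]
  have hmain := landau_cutoff hB hh hΩ hG sψ hC hC' hsupp
  set N : Plane → ℝ := {x | t x < 4}.indicator (fun x => ‖u x‖ ^ 2) with hN
  have hms : MeasurableSet {x | t x < 4} := measurableSet_lt ht.continuous.measurable measurable_const
  have iu := L2_integrable_norm_sq u
  have iN : IntegrableOn N Ω := Integrable.indicator iu hms
  have iψ : IntegrableOn (fun x => ‖ψ x * u x‖ ^ 2) Ω := by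
    have m1 := memLp_mul_of_bound sψ.continuous hC (Lp.memLp u)
    exact (memLp_two_iff_integrable_sq_norm m1.1).1 m1
  have hlow : ‖u‖ ^ 2 ≤ (∫ x in Ω, ‖ψ x * u x‖ ^ 2) + ∫ x in Ω, N x := by
    rw [L2_norm_sq, ← integral_add iψ iN]
    refine integral_mono iu (iψ.add iN) fun x => ?_
    dsimp only
    by_cases hx : t x < 4
    · have : N x = ‖u x‖ ^ 2 := indicator_of_mem (s := {x | t x < 4}) hx _
      rw [this]
      linarith [sq_nonneg ‖ψ x * u x‖]
    · have : N x = 0 := indicator_of_notMem (s := {x | t x < 4}) hx _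
      rw [this, hψ]
      dsimp only
      rw [hfar x (not_lt.1 hx)]
      simp
  have hup : ∀ j, ∫ x in Ω, ‖ψ x * G j x - Complex.I * h * partialDeriv j ψ x * u x‖ ^ 2 ≤
      ‖G j‖ ^ 2 + h * m ^ 2 * ∫ x in Ω, N x := by
    intro j
    have iG := L2_integrable_norm_sq (G j)
    rw [L2_norm_sq, ← integral_const_mul, ← integral_add iG (iN.const_mul _)]
    refine integral_mono_of_nonneg (Eventually.of_forall fun x => by positivity)
      (iG.add (iN.const_mul _)) (Eventually.of_forall fun x => ?_)
    dsimp only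
    rw [dψ]
    by_cases hx : t x < 4
    · have : N x = ‖u x‖ ^ 2 := indicator_of_mem (s := {x | t x < 4}) hx _
      rw [this]
      have hb : ‖Complex.I * h * realPartialDeriv j θ x * u x‖ ≤ √h * m * ‖u x‖ := by
        rw [norm_mul, norm_mul, norm_mul, Complex.norm_I, one_mul, Complex.norm_real,
          Complex.norm_real, Real.norm_of_nonneg hh.le]
        refine mul_le_mul_of_nonneg_right ?_ (norm_nonneg _)
        calc h * ‖realPartialDeriv j θ x‖ ≤ h * (m / √h) := by gcongr; exact bθ j x
          _ = √h * m := by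
            rw [mul_div_assoc', div_eq_iff hsq.ne']
            nlinarith [Real.mul_self_sqrt hh.le]
      have hle := norm_sin_sub_cos_sq_le (θ x) (G j x)
        (Complex.I * h * realPartialDeriv j θ x * u x)
      have hb2 := pow_le_pow_left₀ (norm_nonneg _) hb 2
      calc _ = ‖(Real.sin (θ x) : ℂ) * G j x - (Real.cos (θ x) : ℂ) *
            (Complex.I * h * realPartialDeriv j θ x * u x)‖ ^ 2 := by
            rw [hψ]; ring_nf
        _ ≤ _ := hle.trans (add_le_add_right hb2 _)
        _ = _ := by rw [mul_pow, mul_pow, Real.sq_sqrt hh.le]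
    · have : N x = 0 := indicator_of_notMem (s := {x | t x < 4}) hx _
      rw [this, hψ]
      dsimp only
      rw [hfar x (not_lt.1 hx)]
      simp
  rw [Fin.sum_univ_two] at hmain ⊢
  have h0 := hup 0
  have h1 := hup 1
  have h2 := mul_le_mul_of_nonneg_left hlow (by positivity : 0 ≤ h * B)
  nlinarith

/-! ### Distances and openness of the domain -/

/-- A smooth, Lipschitz substitute for the distance to `Z` in units of `s`. -/
lemma exists_smooth_infDist (Z : Set Plane) {s : ℝ} (hs : 0 < s) : ∃ t : Plane → ℝ,
    ContDiff ℝ ∞ t ∧ LipschitzWith (Real.toNNReal (1 / s)) t ∧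
      ∀ x, Metric.infDist x Z / s ≤ t x ∧ t x ≤ Metric.infDist x Z / s + 2 := by
  set φ : ContDiffBump (0 : Plane) := ⟨s / 2, s, by positivity, by linarith⟩ with hφ
  set d : Plane → ℝ := fun x => Metric.infDist x Z with hd
  have cd : Continuous d := Metric.continuous_infDist_pt Z
  have ld : ∀ x y, |d x - d y| ≤ dist x y := fun x y => by
    simpa [Real.dist_eq] using (Metric.lipschitz_infDist_pt Z).dist_le_mul x y
  set D : Plane → ℝ := φ.normed volume ⋆[ContinuousLinearMap.lsmul ℝ ℝ, volume] d with hD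
  have hll : LocallyIntegrable d (volume : Measure Plane) := cd.locallyIntegrable
  have sD : ContDiff ℝ ∞ D :=
    φ.hasCompactSupport_normed.contDiff_convolution_left _ (n := ⊤) φ.contDiff_normed hll
  have hclose : ∀ x, |D x - d x| ≤ s := by
    intro x
    have := φ.dist_normed_convolution_le (μ := (volume : Measure Plane)) (g := d) (x₀ := x) (ε := s)
      cd.aestronglyMeasurable (fun y hy => by
        rw [Real.dist_eq]
        exact (ld y x).trans (Metric.mem_ball.1 hy).le)
    rwa [Real.dist_eq] at this
  have hex : ∀ x, Integrable (fun y => φ.normed volume y * d (x - y)) volume := fun x =>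
    φ.hasCompactSupport_normed.convolutionExists_left (ContinuousLinearMap.lsmul ℝ ℝ)
      φ.continuous_normed hll x
  have hDx : ∀ x, D x = ∫ y, φ.normed volume y * d (x - y) := fun x => rfl
  have hlip : ∀ x y, |D x - D y| ≤ dist x y := by
    intro x y
    rw [hDx, hDx, ← integral_sub (hex x) (hex y), ← Real.norm_eq_abs]
    calc _ ≤ ∫ z, φ.normed volume z * dist x y := by
          refine norm_integral_le_of_norm_le (φ.integrable_normed.mul_const _)
            (Eventually.of_forall fun z => ?_)
          rw [← mul_sub, norm_mul, Real.norm_of_nonneg (φ.nonneg_normed z), Real.norm_eq_abs]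
          refine mul_le_mul_of_nonneg_left ?_ (φ.nonneg_normed z)
          simpa using ld (x - z) (y - z)
      _ = dist x y := by rw [integral_mul_const, φ.integral_normed, one_mul]
  -- Averaging over radius `s` moves a 1-Lipschitz function by at most `s`. The shift by 1 places
  -- the result above the distance in units of `s`.
  refine ⟨fun x => D x / s + 1, (sD.div_const s).add contDiff_const,
    LipschitzWith.of_dist_le_mul fun x y => ?_, fun x => ?_⟩
  · rw [Real.coe_toNNReal _ (by positivity), Real.dist_eq, add_sub_add_right_eq_sub, ← sub_div,
      abs_div, abs_of_pos hs, div_eq_mul_one_div, mul_comm]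
    exact mul_le_mul_of_nonneg_left (hlip x y) (by positivity)
  · have h1 := abs_le.1 (hclose x)
    constructor
    · rw [div_le_iff₀ hs, add_mul, div_mul_cancel₀ _ hs.ne']
      linarith [h1.1]
    · have : D x / s ≤ d x / s + 1 := by
        rw [div_le_iff₀ hs, add_mul, div_mul_cancel₀ _ hs.ne']
        linarith [h1.2]
      linarith

/-- The segment from `x` to a nearest point of the complement crosses the frontier. If the
complement is empty, both distances have the default value 0. -/
lemma infDist_frontier_le_infDist_compl {Ω : Set Plane} (hΩ : IsOpen Ω) {x : Plane} (hx : x ∈ Ω) :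
    Metric.infDist x (frontier Ω) ≤ Metric.infDist x Ωᶜ := by
  rcases Ωᶜ.eq_empty_or_nonempty with h | h
  · rw [compl_empty_iff.1 h]; simp
  · obtain ⟨y, hy, hxy⟩ := hΩ.isClosed_compl.exists_infDist_eq_dist h x
    rw [hxy]
    have hpre : IsPreconnected (segment ℝ x y) := (convex_segment x y).isPreconnected
    obtain ⟨z, hz, hzf⟩ : ∃ z ∈ segment ℝ x y, z ∈ frontier Ω := by
      by_contra! hcon
      have hsub : segment ℝ x y ⊆ Ω ∪ (closure Ω)ᶜ := by
        intro z hz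
        by_contra hz'
        rw [mem_union, not_or, mem_compl_iff, not_not] at hz'
        exact hcon z hz ⟨hz'.2, by rw [hΩ.interior_eq]; exact hz'.1⟩
      have := hpre.subset_left_of_subset_union hΩ isClosed_closure.isOpen_compl
        (disjoint_compl_right.mono_right (compl_subset_compl.2 subset_closure)) hsub
        ⟨x, left_mem_segment ℝ x y, hx⟩
      exact hy (this (right_mem_segment ℝ x y))
    refine (Metric.infDist_le_dist_of_mem hzf).trans ?_
    rw [dist_eq_norm, dist_eq_norm, norm_sub_rev, norm_sub_rev x y]
    exact norm_sub_le_of_mem_segment hz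

/-- A uniformly separated set is closed, and in the plane the union of closed balls around a closed
set is its closed thickening. Infinitely many disks are therefore harmless. -/
lemma isOpen_obstacleDomain {V : Set Plane} {R : ℝ} (hR : 0 < R)
    (hV : ENNReal.ofReal (2 * R) < V.einfsep) : IsOpen (obstacleDomain V R) := by
  have hc : IsClosed V := Metric.isClosed_of_pairwise_le_dist (ε := 2 * R) (by positivity)
    (fun x hx y hy hxy => by
      have h := hV.le.trans (Set.einfsep_le_edist_of_mem hx hy hxy)
      rw [edist_dist] at h
      exact (ENNReal.ofReal_le_ofReal_iff dist_nonneg).1 h)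
  rw [obstacleDomain, isOpen_compl_iff, ← hc.cthickening_eq_biUnion_closedBall hR.le]
  exact Metric.isClosed_cthickening

/-! ### Weights as multiplication operators and the localization formula -/

section Multiplication

variable {Ω : Set Plane}

/-- Multiplication by a bounded continuous real function on `L²(Ω)`. -/
noncomputable def mulL2 (Ω : Set Plane) (f : BoundedContinuousFunction Plane ℝ) :
    L2 Ω →L[ℂ] L2 Ω :=
  LinearMap.mkContinuous
    { toFun := fun u => (memLp_mul_of_bound (f := fun x => (f x : ℂ))
        (Complex.continuous_ofReal.comp f.continuous) (C := ‖f‖)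
        (fun x => by rw [Complex.norm_real]; exact f.norm_coe_le_norm x) (Lp.memLp u)).toLp _
      map_add' := fun u v => by
        rw [← MemLp.toLp_add]
        refine MemLp.toLp_congr _ _ ?_
        filter_upwards [Lp.coeFn_add u v] with x hx
        simp only [hx, Pi.add_apply, mul_add]
      map_smul' := fun c u => by
        rw [RingHom.id_apply, ← MemLp.toLp_const_smul]
        refine MemLp.toLp_congr _ _ ?_
        filter_upwards [Lp.coeFn_smul c u] with x hx
        simp only [hx, Pi.smul_apply, smul_eq_mul]
        ring } ‖f‖
    (fun u => by
      refine Lp.norm_le_mul_norm_of_ae_le_mul ?_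
      simp only [LinearMap.coe_mk, AddHom.coe_mk]
      filter_upwards [(memLp_mul_of_bound (f := fun x => (f x : ℂ))
        (Complex.continuous_ofReal.comp f.continuous) (C := ‖f‖)
        (fun x => by rw [Complex.norm_real]; exact f.norm_coe_le_norm x)
          (Lp.memLp u)).coeFn_toLp] with x hx
      rw [hx, norm_mul, Complex.norm_real]
      exact mul_le_mul_of_nonneg_right (f.norm_coe_le_norm x) (norm_nonneg _))

lemma coeFn_mulL2 (f : BoundedContinuousFunction Plane ℝ) (u : L2 Ω) :
    mulL2 Ω f u =ᵐ[volume.restrict Ω] fun x => (f x : ℂ) * u x :=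
  (memLp_mul_of_bound (f := fun x => (f x : ℂ)) (Complex.continuous_ofReal.comp f.continuous)
    (C := ‖f‖) (fun x => by rw [Complex.norm_real]; exact f.norm_coe_le_norm x)
    (Lp.memLp u)).coeFn_toLp

lemma inner_mulL2 (f : BoundedContinuousFunction Plane ℝ) (u v : L2 Ω) :
    inner ℂ (mulL2 Ω f u) v = inner ℂ u (mulL2 Ω f v) := by
  rw [L2.inner_def, L2.inner_def]
  refine integral_congr_ae ?_
  filter_upwards [coeFn_mulL2 f u, coeFn_mulL2 f v] with x h1 h2
  rw [h1, h2]
  simp only [RCLike.inner_apply, map_mul, Complex.conj_ofReal]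
  ring

/-- Product rule for the magnetic gradient. -/
lemma IsMagneticGradient.exists_mulL2 {B h : ℝ} {u : L2 Ω} {G : Fin 2 → L2 Ω}
    (hG : IsMagneticGradient B h Ω u G) (f : BoundedContinuousFunction Plane ℝ)
    (hf : ContDiff ℝ ∞ f) {C : ℝ} (hC : ∀ j x, |realPartialDeriv j f x| ≤ C) :
    ∃ k : Fin 2 → L2 Ω, IsMagneticGradient B h Ω (mulL2 Ω f u) k ∧
      ∀ j, k j =ᵐ[volume.restrict Ω] fun x =>
        (f x : ℂ) * G j x - Complex.I * h * realPartialDeriv j f x * u x := by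
  have sf : ContDiff ℝ ∞ fun x => (f x : ℂ) := Complex.ofRealCLM.contDiff.comp hf
  have df : ∀ j, partialDeriv j (fun x => (f x : ℂ)) = fun x => (realPartialDeriv j f x : ℂ) :=
    fun j => funext fun x => partialDeriv_ofReal j (hf.differentiable (by simp) x)
  have cdf : ∀ j, Continuous fun x => (realPartialDeriv j f x : ℂ) := fun j => by
    rw [← df]; exact (partialDeriv_contDiff j sf).continuous
  have m : ∀ j, MemLp (fun x => (f x : ℂ) * G j x - Complex.I * h * realPartialDeriv j f x * u x) 2
      (volume.restrict Ω) := fun j =>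
    (memLp_mul_of_bound sf.continuous (C := ‖f‖)
      (fun x => by rw [Complex.norm_real]; exact f.norm_coe_le_norm x) (Lp.memLp (G j))).sub
      (memLp_mul_of_bound (C := |h| * C) (continuous_const.mul (cdf j)) (fun x => by
          rw [norm_mul, norm_mul, Complex.norm_I, one_mul, Complex.norm_real, Complex.norm_real]
          exact mul_le_mul_of_nonneg_left (hC j x) (abs_nonneg h)) (Lp.memLp u))
  refine ⟨fun j => (m j).toLp _, fun j φ hφ hc hs => ?_, fun j => (m j).coeFn_toLp⟩
  rw [integral_toLp_mul]
  have h1 := integral_magnetic_mul (volume.restrict Ω) B h j (Lp.memLp u) (Lp.memLp (G j)) sf hφ hc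
      (hG j _ (sf.mul hφ) hc.mul_left ((tsupport_mul_subset_right).trans hs))
  rw [df] at h1
  rw [h1]
  refine integral_congr_ae ?_
  filter_upwards [coeFn_mulL2 f u] with x hx
  rw [hx]

lemma re_inner_eq_integral (u v : L2 Ω) :
    (inner ℂ u v).re = ∫ x in Ω, ((starRingEnd ℂ) (u x) * v x).re := by
  rw [L2.inner_def]
  have h := (integral_re (L2.integrable_inner (𝕜 := ℂ) u v)).symm
  refine h.trans (integral_congr_ae (Eventually.of_forall fun x => ?_))
  simp [RCLike.inner_apply, mul_comm]

lemma integrable_sq_mul_norm_sq (u : L2 Ω) {f : Plane → ℝ} (hf : Continuous f) {C : ℝ}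
    (hC : ∀ x, |f x| ≤ C) : IntegrableOn (fun x => f x ^ 2 * ‖u x‖ ^ 2) Ω := by
  have m := memLp_mul_of_bound (f := fun x => (f x : ℂ)) (Complex.continuous_ofReal.comp hf)
    (fun x => by rw [Complex.norm_real]; exact hC x) (Lp.memLp u)
  refine ((memLp_two_iff_integrable_sq_norm m.1).1 m).congr (Eventually.of_forall fun x => ?_)
  simp only [norm_mul, Complex.norm_real, mul_pow, Real.norm_eq_abs, sq_abs]

lemma norm_mulL2_sq (f : BoundedContinuousFunction Plane ℝ) (u : L2 Ω) :
    ‖mulL2 Ω f u‖ ^ 2 = ∫ x in Ω, f x ^ 2 * ‖u x‖ ^ 2 := by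
  rw [L2_norm_sq]
  refine integral_congr_ae ?_
  filter_upwards [coeFn_mulL2 f u] with x hx
  rw [hx, norm_mul, Complex.norm_real, mul_pow, Real.norm_eq_abs, sq_abs]

/-- The localization formula for the weak form of the equation `L u = F`. -/
lemma re_inner_mulL2_eq {B h : ℝ} {u F : L2 Ω} {G : Fin 2 → L2 Ω}
    (hF : ∀ (v : L2 Ω) (k : Fin 2 → L2 Ω), IsMagneticGradient B h Ω v k →
      ∑ j, inner ℂ (k j) (G j) = inner ℂ v F)
    (f : BoundedContinuousFunction Plane ℝ) (hf : ContDiff ℝ ∞ f) {C : ℝ}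
    (hC : ∀ j x, |realPartialDeriv j f x| ≤ C) {l : Fin 2 → L2 Ω}
    (hl : IsMagneticGradient B h Ω (mulL2 Ω f u) l)
    (hlG : ∀ j, l j =ᵐ[volume.restrict Ω] fun x =>
        (f x : ℂ) * G j x - Complex.I * h * realPartialDeriv j f x * u x) :
    (inner ℂ (mulL2 Ω f u) (mulL2 Ω f F)).re =
      ∑ j, (‖l j‖ ^ 2 - h ^ 2 * ∫ x in Ω, realPartialDeriv j f x ^ 2 * ‖u x‖ ^ 2) := by
  -- The equation is tested against `f² u`, written as `f` times `f u` so that the product rule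
  -- applies twice.
  obtain ⟨k, hk, hkl⟩ := hl.exists_mulL2 f hf hC
  have cd : ∀ j, Continuous (realPartialDeriv j f) := fun j =>
    (hf.continuous_fderiv (by simp)).clm_apply continuous_const
  rw [← inner_mulL2, ← hF _ k hk, Complex.re_sum]
  refine Finset.sum_congr rfl fun j _ => ?_
  rw [re_inner_eq_integral, L2_norm_sq, ← integral_const_mul, ← integral_sub
    (L2_integrable_norm_sq _) ((integrable_sq_mul_norm_sq u (cd j) (hC j)).const_mul _)]
  refine integral_congr_ae ?_
  -- Substituting `f G = l + i h ∂f u`, the terms linear in `∂f` are purely imaginary and leave the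
  -- real part.
  filter_upwards [hkl j, hlG j, coeFn_mulL2 f u] with x h1 h2 h3
  rw [h1, h3, h2]
  simp only [← Complex.normSq_eq_norm_sq, Complex.normSq_apply]
  simp
  ring

end Multiplication

/-! ### The Neumann operator on low energy spectral subspaces -/

section Operator

variable {B h : ℝ} {Ω : Set Plane}

lemma magneticNeumannLaplacian_spec (hΩ : IsOpen Ω)
    (x : (magneticNeumannLaplacian B h Ω).domain) : ∃ g : Fin 2 → L2 Ω,
      IsMagneticGradient B h Ω x g ∧ ∀ (v : L2 Ω) (k : Fin 2 → L2 Ω),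
        IsMagneticGradient B h Ω v k →
          ∑ j, inner ℂ (k j) (g j) = inner ℂ v (magneticNeumannLaplacian B h Ω x) :=
  Submodule.mem_graph_toLinearPMap (magneticNeumannGraph_singleValued B h hΩ) x

lemma re_inner_eq_sum_norm_sq {u F : L2 Ω} {g : Fin 2 → L2 Ω}
    (hg : IsMagneticGradient B h Ω u g)
    (hF : ∀ (v : L2 Ω) (k : Fin 2 → L2 Ω), IsMagneticGradient B h Ω v k →
      ∑ j, inner ℂ (k j) (g j) = inner ℂ v F) : (inner ℂ u F).re = ∑ j, ‖g j‖ ^ 2 := by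
  rw [← hF u g hg, Complex.re_sum]
  refine Finset.sum_congr rfl fun j _ => ?_
  exact inner_self_eq_norm_sq (𝕜 := ℂ) (g j)

lemma magneticNeumannLaplacian_nonneg (hΩ : IsOpen Ω)
    (x : (magneticNeumannLaplacian B h Ω).domain) :
    0 ≤ (inner ℂ (x : L2 Ω) (magneticNeumannLaplacian B h Ω x)).re := by
  obtain ⟨g, hg, hF⟩ := magneticNeumannLaplacian_spec hΩ x
  rw [re_inner_eq_sum_norm_sq hg hF]
  positivity

/-- The operator is bounded on the spectral subspaces of bounded energy. -/
lemma norm_magneticNeumannLaplacian_le (hΩ : IsOpen Ω) {E : SpectralResolution (L2 Ω)}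
    (hE : E.IsResolutionOf (magneticNeumannLaplacian B h Ω)) {a : ℝ} (ha : 0 ≤ a)
    (x : (magneticNeumannLaplacian B h Ω).domain) (hx : E.proj (Iic a) x = x) :
    ‖magneticNeumannLaplacian B h Ω x‖ ≤ a * ‖(x : L2 Ω)‖ := by
  -- Since `y = T x` stays in the spectral subspace, it is in the domain and obeys the same energy
  -- bound. Then `‖y‖² = ⟨y, T x⟩` is a value of the form, and Cauchy–Schwarz for the form suffices.
  have hw := hE.proj_Iic_apply x hx
  have hdom := hE.mem_domain_of_Iic (magneticNeumannLaplacian_nonneg hΩ) hw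
  set y := magneticNeumannLaplacian B h Ω x with hy
  set w : (magneticNeumannLaplacian B h Ω).domain := ⟨y, hdom⟩
  obtain ⟨g, hg, hF⟩ := magneticNeumannLaplacian_spec hΩ x
  obtain ⟨k, hk, hF'⟩ := magneticNeumannLaplacian_spec hΩ w
  have e1 : ∑ j, ‖g j‖ ^ 2 ≤ a * ‖(x : L2 Ω)‖ ^ 2 := by
    rw [← re_inner_eq_sum_norm_sq hg hF]; exact hE.inner_le_of_Iic x hx
  have e2 : ∑ j, ‖k j‖ ^ 2 ≤ a * ‖y‖ ^ 2 := by
    rw [← re_inner_eq_sum_norm_sq hk hF']; exact hE.inner_le_of_Iic w hw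
  have e3 : ‖y‖ ^ 2 ≤ ∑ j, ‖k j‖ * ‖g j‖ := by
    have h1 : (inner ℂ y y).re = ‖y‖ ^ 2 := inner_self_eq_norm_sq (𝕜 := ℂ) y
    rw [← h1, ← hF y k hk, Complex.re_sum]
    exact Finset.sum_le_sum fun j _ => (Complex.re_le_norm _).trans (norm_inner_le_norm _ _)
  have e4 := Finset.sum_mul_sq_le_sq_mul_sq Finset.univ (fun j => ‖k j‖) (fun j => ‖g j‖)
  have e5 : (‖y‖ ^ 2) ^ 2 ≤ (a * ‖y‖ ^ 2) * (a * ‖(x : L2 Ω)‖ ^ 2) :=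
    (pow_le_pow_left₀ (by positivity) e3 2).trans (e4.trans
      (mul_le_mul e2 e1 (by positivity) (by positivity)))
  by_cases h0 : ‖y‖ = 0
  · rw [h0]; positivity
  · have hpos : 0 < ‖y‖ ^ 2 := by positivity
    have e6 : ‖y‖ ^ 2 ≤ (a * ‖(x : L2 Ω)‖) ^ 2 := by
      refine le_of_mul_le_mul_left ?_ hpos
      calc _ = (‖y‖ ^ 2) ^ 2 := by ring
        _ ≤ _ := e5
        _ = _ := by ring
    exact (pow_le_pow_iff_left₀ (norm_nonneg _) (by positivity) two_ne_zero).1 e6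

end Operator

/-! ### The Agmon estimate for bounded weights -/

/-- The weighted estimate, uniformly in the bounded weight `f`. -/
lemma exists_weighted_bound {B b κ : ℝ} (hB : 0 < B) (hb : 0 ≤ b) (hκ : 0 < κ)
    (hbκ : b + 2 * κ ^ 2 < B) : ∃ C > 0, ∀ h : ℝ, 0 < h → ∀ Ω : Set Plane, IsOpen Ω →
    ∀ t : Plane → ℝ, ContDiff ℝ ∞ t → LipschitzWith (Real.toNNReal (1 / √h)) t →
    {x | 3 ≤ t x} ⊆ Ω → ∀ E : SpectralResolution (L2 Ω),
    E.IsResolutionOf (magneticNeumannLaplacian B h Ω) → ∀ Ψ : L2 Ω,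
    E.proj (Iic (b * h)) Ψ = Ψ → ∃ G : Fin 2 → L2 Ω, IsMagneticGradient B h Ω Ψ G ∧
    ∀ f : BoundedContinuousFunction Plane ℝ, ContDiff ℝ ∞ f → (∀ x, 0 < f x) →
      (∀ x, t x < 4 → f x ≤ Real.exp (4 * κ)) →
      (∀ j x, |realPartialDeriv j f x| ≤ κ / √h * f x) →
      ∫ x in Ω, f x ^ 2 * (‖Ψ x‖ ^ 2 + h⁻¹ * ∑ j, ‖G j x‖ ^ 2) ≤ C * ‖Ψ‖ ^ 2 := by
  obtain ⟨C₁, hC₁, hlow⟩ := exists_neumann_lower_bound hB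
  set c₀ : ℝ := C₁ * Real.exp (4 * κ) ^ 2 with hc₀
  set D : ℝ := c₀ / (B - 2 * κ ^ 2 - b) with hD
  have hden : 0 < B - 2 * κ ^ 2 - b := by linarith
  have hD0 : 0 < D := by positivity
  refine ⟨D * (1 + 2 * b + 8 * κ ^ 2), by positivity,
    fun h hh Ω hΩ t ht htl hts E hE Ψ hΨ => ?_⟩
  classical
  set T := magneticNeumannLaplacian B h Ω with hT
  have hnn := magneticNeumannLaplacian_nonneg (B := B) (h := h) hΩ
  have hsq : 0 < √h := Real.sqrt_pos.2 hh
  have ha : 0 ≤ b * h := by positivity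
  have hdom : ∀ v, E.proj (Iic (b * h)) v = v → v ∈ T.domain := fun v hv =>
    hE.mem_domain_of_Iic hnn hv
  set A : L2 Ω → L2 Ω := fun v => if hv : v ∈ T.domain then T ⟨v, hv⟩ else 0 with hAdef
  have hA : ∀ v (hv : v ∈ T.domain), A v = T ⟨v, hv⟩ := fun v hv => dif_pos hv
  set K : Submodule ℂ (L2 Ω) := LinearMap.eqLocus (E.proj (Iic (b * h))).toLinearMap LinearMap.id
    with hK
  have hKm : ∀ v, v ∈ K ↔ E.proj (Iic (b * h)) v = v := fun v => Iff.rfl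
  have hAK : ∀ v ∈ K, A v ∈ K := fun v hv => by
    rw [hA v (hdom v hv)]; exact hE.proj_Iic_apply ⟨v, hdom v hv⟩ hv
  have hAn : ∀ v ∈ K, ‖A v‖ ≤ b * h * ‖v‖ := fun v hv => by
    rw [hA v (hdom v hv)]
    exact norm_magneticNeumannLaplacian_le hΩ hE ha ⟨v, hdom v hv⟩ hv
  have hAi : ∀ v ∈ K, (inner ℂ v (A v)).re ≤ b * h * ‖v‖ ^ 2 := fun v hv => by
    rw [hA v (hdom v hv)]; exact hE.inner_le_of_Iic ⟨v, hdom v hv⟩ hv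
  have hspec : ∀ v ∈ K, ∃ g : Fin 2 → L2 Ω, IsMagneticGradient B h Ω v g ∧
      ∀ (w : L2 Ω) (k : Fin 2 → L2 Ω), IsMagneticGradient B h Ω w k →
        ∑ j, inner ℂ (k j) (g j) = inner ℂ w (A v) := fun v hv => by
    rw [hA v (hdom v hv)]; exact magneticNeumannLaplacian_spec hΩ ⟨v, hdom v hv⟩
  obtain ⟨G, hG, hGF⟩ := hspec Ψ hΨ
  refine ⟨G, hG, fun f hf hf0 hf4 hfd => ?_⟩
  have hfb : ∀ x, |f x| ≤ ‖f‖ := fun x => f.norm_coe_le_norm x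
  have hfdb : ∀ j x, |realPartialDeriv j f x| ≤ κ / √h * ‖f‖ := fun j x =>
    (hfd j x).trans (mul_le_mul_of_nonneg_left ((le_abs_self _).trans (hfb x)) (by positivity))
  have cd : ∀ j, Continuous (realPartialDeriv j f) := fun j =>
    (hf.continuous_fderiv (by simp)).clm_apply continuous_const
  set Y := mulL2 Ω f with hY
  -- Each direction costs `κ² h` times the weighted mass; the two together account for the `2 κ²`
  -- subtracted from `B`.
  have herr : ∀ v : L2 Ω, ∀ j, h ^ 2 * ∫ x in Ω, realPartialDeriv j f x ^ 2 * ‖v x‖ ^ 2 ≤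
      κ ^ 2 * h * ‖Y v‖ ^ 2 := by
    intro v j
    rw [hY, norm_mulL2_sq, ← integral_const_mul, ← integral_const_mul]
    refine integral_mono ((integrable_sq_mul_norm_sq v (cd j) (hfdb j)).const_mul _)
      ((integrable_sq_mul_norm_sq v f.continuous hfb).const_mul _) fun x => ?_
    dsimp only
    have h1 := pow_le_pow_left₀ (abs_nonneg _) (hfd j x) 2
    rw [sq_abs, mul_pow, div_pow, Real.sq_sqrt hh.le] at h1
    calc h ^ 2 * (realPartialDeriv j f x ^ 2 * ‖v x‖ ^ 2)
        ≤ h ^ 2 * (κ ^ 2 / h * f x ^ 2 * ‖v x‖ ^ 2) := by gcongr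
      _ = κ ^ 2 * h * (f x ^ 2 * ‖v x‖ ^ 2) := by field_simp
  -- In the boundary layer the weight is at most `exp (4 κ)`, so the error there is controlled by
  -- the unweighted norm.
  have hnear : ∀ v : L2 Ω, ∫ x in Ω, {x | t x < 4}.indicator (fun x => ‖Y v x‖ ^ 2) x ≤
      Real.exp (4 * κ) ^ 2 * ‖v‖ ^ 2 := by
    intro v
    rw [L2_norm_sq v, ← integral_const_mul]
    refine integral_mono_of_nonneg
      (Eventually.of_forall fun x => indicator_nonneg (fun _ _ => by positivity) x)
      ((L2_integrable_norm_sq v).const_mul _) ?_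
    filter_upwards [coeFn_mulL2 f v] with x hx
    by_cases htx : t x < 4
    · rw [indicator_of_mem (s := {x | t x < 4}) htx, hY, hx, norm_mul, mul_pow, Complex.norm_real,
        Real.norm_of_nonneg (hf0 x).le]
      have := hf4 x htx
      have := (hf0 x).le
      gcongr
    · rw [indicator_of_notMem (s := {x | t x < 4}) htx]
      positivity
  have hYK : ∀ v ∈ K, h * (B - 2 * κ ^ 2) * ‖Y v‖ ^ 2 - h * c₀ * ‖v‖ ^ 2 ≤
      (inner ℂ (Y v) (Y (A v))).re := by
    intro v hv
    obtain ⟨g, hg, hgF⟩ := hspec v hv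
    obtain ⟨l, hl, hlg⟩ := hg.exists_mulL2 f hf hfdb
    rw [hY, re_inner_mulL2_eq hgF f hf hfdb hl hlg, ← hY, Finset.sum_sub_distrib]
    have h1 := hlow h hh Ω hΩ.measurableSet t ht htl hts (Y v) l hl
    have h2 := herr v 0
    have h3 := herr v 1
    have h4 := mul_le_mul_of_nonneg_left (hnear v) (by positivity : 0 ≤ h * C₁)
    rw [Fin.sum_univ_two (f := fun j => h ^ 2 * _)]
    rw [hc₀]
    linarith
  -- The powers of `h` cancel in the quotient, so `D` depends neither on `h` nor on the weight.
  have hmain : ∀ v ∈ K, ‖Y v‖ ^ 2 ≤ D * ‖v‖ ^ 2 := by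
    intro v hv
    have := norm_sq_le_of_agmon K A Y (a := b * h) (l := h * (B - 2 * κ ^ 2)) (c := h * c₀) ha
      (by nlinarith) (by positivity) hAK hAn hAi hYK hv
    have e : h * c₀ / (h * (B - 2 * κ ^ 2) - b * h) = D := by
      rw [hD, show h * (B - 2 * κ ^ 2) - b * h = h * (B - 2 * κ ^ 2 - b) by ring,
        mul_div_mul_left _ _ hh.ne']
    rwa [e] at this
  have hY1 := hmain Ψ hΨ
  -- `A Ψ` is again in `K`, so it has its own weighted bound; this stands in for an eigenvalue
  -- equation in the gradient estimate.
  have hY2 : ‖Y (A Ψ)‖ ^ 2 ≤ D * (b * h * ‖Ψ‖) ^ 2 :=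
    (hmain _ (hAK Ψ hΨ)).trans (mul_le_mul_of_nonneg_left
      (pow_le_pow_left₀ (norm_nonneg _) (hAn Ψ hΨ) 2) hD0.le)
  have hYY : ‖Y Ψ‖ * ‖Y (A Ψ)‖ ≤ D * (b * h) * ‖Ψ‖ ^ 2 := by
    refine (pow_le_pow_iff_left₀ (by positivity) (by positivity) two_ne_zero).1 ?_
    calc (‖Y Ψ‖ * ‖Y (A Ψ)‖) ^ 2 = ‖Y Ψ‖ ^ 2 * ‖Y (A Ψ)‖ ^ 2 := by ring
      _ ≤ (D * ‖Ψ‖ ^ 2) * (D * (b * h * ‖Ψ‖) ^ 2) :=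
        mul_le_mul hY1 hY2 (by positivity) (by positivity)
      _ = _ := by ring
  obtain ⟨l, hl, hlg⟩ := hG.exists_mulL2 f hf hfdb
  have hid := re_inner_mulL2_eq hGF f hf hfdb hl hlg
  rw [← hY, Finset.sum_sub_distrib, Fin.sum_univ_two (f := fun j => h ^ 2 * _)] at hid
  have hin : (inner ℂ (Y Ψ) (Y (A Ψ))).re ≤ ‖Y Ψ‖ * ‖Y (A Ψ)‖ :=
    (Complex.re_le_norm _).trans (norm_inner_le_norm _ _)
  have hGj : ∀ j, ∫ x in Ω, f x ^ 2 * ‖G j x‖ ^ 2 ≤ 2 * ‖l j‖ ^ 2 +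
      2 * (h ^ 2 * ∫ x in Ω, realPartialDeriv j f x ^ 2 * ‖Ψ x‖ ^ 2) := by
    intro j
    have i1 := (L2_integrable_norm_sq (l j)).const_mul 2
    have i2 := ((integrable_sq_mul_norm_sq Ψ (cd j) (hfdb j)).const_mul (h ^ 2)).const_mul 2
    rw [L2_norm_sq, ← integral_const_mul, ← integral_const_mul, ← integral_const_mul,
      ← integral_add i1 i2]
    refine integral_mono_ae (integrable_sq_mul_norm_sq (G j) f.continuous hfb) (i1.add i2) ?_
    filter_upwards [hlg j] with x hx
    have e1 : (f x : ℂ) * G j x = l j x + Complex.I * h * realPartialDeriv j f x * Ψ x := by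
      rw [hx]; ring
    have e2 : f x ^ 2 * ‖G j x‖ ^ 2 = ‖(f x : ℂ) * G j x‖ ^ 2 := by
      rw [norm_mul, mul_pow, Complex.norm_real, Real.norm_eq_abs, sq_abs]
    have e3 : ‖Complex.I * h * realPartialDeriv j f x * Ψ x‖ ^ 2 =
        h ^ 2 * (realPartialDeriv j f x ^ 2 * ‖Ψ x‖ ^ 2) := by
      simp only [norm_mul, mul_pow, Complex.norm_I, Complex.norm_real, Real.norm_eq_abs, sq_abs]
      ring
    rw [e2, e1]
    rw [← e3]
    have h1 := pow_le_pow_left₀ (norm_nonneg _)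
      (norm_add_le (l j x) (Complex.I * h * realPartialDeriv j f x * Ψ x)) 2
    nlinarith [sq_nonneg (‖l j x‖ - ‖Complex.I * h * realPartialDeriv j f x * Ψ x‖)]
  have hsum : ∫ x in Ω, f x ^ 2 * (‖Ψ x‖ ^ 2 + h⁻¹ * ∑ j, ‖G j x‖ ^ 2) =
      ‖Y Ψ‖ ^ 2 + h⁻¹ * ((∫ x in Ω, f x ^ 2 * ‖G 0 x‖ ^ 2) + ∫ x in Ω, f x ^ 2 * ‖G 1 x‖ ^ 2) := by
    have i0 := integrable_sq_mul_norm_sq Ψ f.continuous hfb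
    have i1 := integrable_sq_mul_norm_sq (G 0) f.continuous hfb
    have i2 := integrable_sq_mul_norm_sq (G 1) f.continuous hfb
    have i3 : IntegrableOn (fun x => f x ^ 2 * ‖G 0 x‖ ^ 2 + f x ^ 2 * ‖G 1 x‖ ^ 2) Ω := i1.add i2
    rw [hY, norm_mulL2_sq, ← integral_add i1 i2, ← integral_const_mul,
      ← integral_add i0 (i3.const_mul _)]
    refine integral_congr_ae (Eventually.of_forall fun x => ?_)
    simp only [Fin.sum_univ_two]
    ring
  rw [hsum]
  have g0 := hGj 0
  have g1 := hGj 1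
  have r0 := herr Ψ 0
  have r1 := herr Ψ 1
  rw [Fin.sum_univ_two] at hid
  -- The localization formula bounds `∑ ‖l j‖²` by `h D (b + 2 κ²) ‖Ψ‖²`. Doubling it and adding the
  -- doubled errors `4 κ² h D ‖Ψ‖²` gives `2 b + 8 κ²`.
  have htot : (∫ x in Ω, f x ^ 2 * ‖G 0 x‖ ^ 2) + (∫ x in Ω, f x ^ 2 * ‖G 1 x‖ ^ 2) ≤
      h * (D * (2 * b + 8 * κ ^ 2) * ‖Ψ‖ ^ 2) := by
    have := mul_le_mul_of_nonneg_left hY1 (by positivity : 0 ≤ κ ^ 2 * h)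
    nlinarith
  calc ‖Y Ψ‖ ^ 2 + h⁻¹ * _ ≤ D * ‖Ψ‖ ^ 2 + h⁻¹ * (h * (D * (2 * b + 8 * κ ^ 2) * ‖Ψ‖ ^ 2)) := by
        gcongr
    _ = D * (1 + 2 * b + 8 * κ ^ 2) * ‖Ψ‖ ^ 2 := by field_simp; ring

/-! ### From bounded weights to the exponential weight -/

/-- Fatou's lemma for an integral with a sequence of weights. -/
lemma integrableOn_and_le_of_weights {Ω : Set Plane} (hΩ : MeasurableSet Ω) {W q : Plane → ℝ}
    {p : ℕ → Plane → ℝ} {M : ℝ} (hM : 0 ≤ M)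
    (hWm : AEStronglyMeasurable W (volume.restrict Ω)) (hW : ∀ x, 0 ≤ W x) (hp0 : ∀ n x, 0 ≤ p n x)
    (hpi : ∀ n, IntegrableOn (fun x => p n x * W x) Ω)
    (hpM : ∀ n, ∫ x in Ω, p n x * W x ≤ M) (hq : Continuous q) (hq0 : ∀ x, 0 ≤ q x)
    (hlim : ∀ x ∈ Ω, ∃ P, Tendsto (fun n => p n x) atTop (𝓝 P) ∧ q x ≤ P) :
    IntegrableOn (fun x => q x * W x) Ω ∧ ∫ x in Ω, q x * W x ≤ M := by
  have hm : AEStronglyMeasurable (fun x => q x * W x) (volume.restrict Ω) :=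
    hq.aestronglyMeasurable.mul hWm
  have h0 : ∀ x, 0 ≤ q x * W x := fun x => mul_nonneg (hq0 x) (hW x)
  have hle : ∫⁻ x in Ω, ENNReal.ofReal (q x * W x) ≤ ENNReal.ofReal M := by
    calc ∫⁻ x in Ω, ENNReal.ofReal (q x * W x)
        ≤ ∫⁻ x in Ω, liminf (fun n => ENNReal.ofReal (p n x * W x)) atTop := by
          refine setLIntegral_mono_ae' hΩ (Eventually.of_forall fun x hx => ?_)
          obtain ⟨P, hP, hqP⟩ := hlim x hx
          rw [(ENNReal.tendsto_ofReal (hP.mul_const (W x))).liminf_eq]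
          exact ENNReal.ofReal_le_ofReal (mul_le_mul_of_nonneg_right hqP (hW x))
      _ ≤ liminf (fun n => ∫⁻ x in Ω, ENNReal.ofReal (p n x * W x)) atTop :=
          lintegral_liminf_le' fun n => (hpi n).1.aemeasurable.ennreal_ofReal
      _ ≤ liminf (fun _ : ℕ => ENNReal.ofReal M) atTop := by
          refine liminf_le_liminf (Eventually.of_forall fun n => ?_)
          rw [← ofReal_integral_eq_lintegral_ofReal (hpi n)
            (Eventually.of_forall fun x => mul_nonneg (hp0 n x) (hW x))]
          exact ENNReal.ofReal_le_ofReal (hpM n)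
      _ = ENNReal.ofReal M := liminf_const _
  refine ⟨⟨hm, ?_⟩, ?_⟩
  · rw [hasFiniteIntegral_iff_ofReal (Eventually.of_forall h0)]
    exact hle.trans_lt ENNReal.ofReal_lt_top
  · rw [integral_eq_lintegral_of_nonneg_ae (Eventually.of_forall h0) hm]
    exact ENNReal.toReal_le_of_le_ofReal hM hle

/-- Bounded smooth weights approximating `exp (κ t)` from below. -/
lemma exists_weight {t : Plane → ℝ} (ht : ContDiff ℝ ∞ t) (ht0 : ∀ x, 0 ≤ t x) {L : ℝ} (hL : 0 ≤ L)
    (htl : LipschitzWith (Real.toNNReal L) t) {κ a : ℝ} (hκ : 0 < κ) (ha : 0 < a) :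
    ∃ f : BoundedContinuousFunction Plane ℝ, ContDiff ℝ ∞ f ∧
      (∀ x, f x = Real.exp (κ * (t x / (1 + a * t x)))) ∧
      ∀ j x, |realPartialDeriv j f x| ≤ κ * L * f x := by
  have hpos : ∀ x, 0 < 1 + a * t x := fun x => by have := ht0 x; positivity
  -- The map `t ↦ t / (1 + a t)` is 1-Lipschitz on `t ≥ 0`, bounded by `1 / a`, and tends to `t` as
  -- `a → 0`. So the gradient bound is uniform in `a`.
  set Φ : Plane → ℝ := fun x => κ * (t x / (1 + a * t x)) with hΦ
  have sΦ : ContDiff ℝ ∞ Φ := contDiff_const.mul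
    (ht.div (contDiff_const.add (contDiff_const.mul ht)) fun x => (hpos x).ne')
  have lΦ : LipschitzWith (Real.toNNReal (κ * L)) Φ := by
    refine LipschitzWith.of_dist_le_mul fun x y => ?_
    have e2 := htl.dist_le_mul x y
    rw [Real.coe_toNNReal _ (by positivity)] at e2 ⊢
    rw [Real.dist_eq] at e2 ⊢
    have e3 : Φ x - Φ y = κ * ((t x - t y) / ((1 + a * t x) * (1 + a * t y))) := by
      have h1 := (hpos x).ne'
      have h2 := (hpos y).ne'
      rw [hΦ]; dsimp only
      rw [← mul_sub, div_sub_div _ _ h1 h2]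
      congr 2
      ring
    have e4 : 1 ≤ (1 + a * t x) * (1 + a * t y) := by
      have h1 := ht0 x
      have h2 := ht0 y
      exact one_le_mul_of_one_le_of_one_le (by nlinarith) (by nlinarith)
    have e5 : 0 < (1 + a * t x) * (1 + a * t y) := one_pos.trans_le e4
    rw [e3, abs_mul, abs_of_pos hκ, abs_div, abs_of_pos e5, mul_assoc]
    refine mul_le_mul_of_nonneg_left ?_ hκ.le
    exact (div_le_self (abs_nonneg _) e4).trans e2
  have hb : ∀ x, ‖Real.exp (Φ x)‖ ≤ Real.exp (κ / a) := fun x => by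
    rw [Real.norm_of_nonneg (Real.exp_pos _).le, Real.exp_le_exp, hΦ]
    dsimp only
    rw [div_eq_mul_one_div κ a]
    refine mul_le_mul_of_nonneg_left ?_ hκ.le
    rw [div_le_div_iff₀ (hpos x) ha]
    nlinarith [ht0 x]
  refine ⟨BoundedContinuousFunction.ofNormedAddCommGroup (fun x => Real.exp (Φ x))
    sΦ.exp.continuous _ hb, sΦ.exp, fun x => rfl, fun j x => ?_⟩
  change |realPartialDeriv j (fun x => Real.exp (Φ x)) x| ≤ κ * L * Real.exp (Φ x)
  rw [realPartialDeriv_exp j (sΦ.differentiable (by simp) x), abs_mul,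
    abs_of_pos (Real.exp_pos _), mul_comm]
  refine mul_le_mul_of_nonneg_right ?_ (Real.exp_pos _).le
  have := abs_realPartialDeriv_le j lΦ x
  rwa [Real.coe_toNNReal _ (by positivity)] at this

/-! ### The de Gennes constant lies below the Landau level -/

lemma deGennesEnergy_bddBelow (ξ : ℝ) : BddBelow {E : ℝ | ∃ u u' : ℝ → ℂ, IsDeGennesForm u u' ∧
    (∫ t in Ioi (0 : ℝ), ‖u t‖ ^ 2) = 1 ∧
    E = ∫ t in Ioi (0 : ℝ), (‖u' t‖ ^ 2 + (t - ξ) ^ 2 * ‖u t‖ ^ 2)} := by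
  refine ⟨0, ?_⟩
  rintro E ⟨u, u', -, -, rfl⟩
  exact integral_nonneg fun t => by positivity

lemma deGennesEnergy_nonneg (ξ : ℝ) : 0 ≤ deGennesEnergy ξ := by
  refine Real.sInf_nonneg ?_
  rintro E ⟨u, u', -, -, rfl⟩
  exact integral_nonneg fun t => by positivity

lemma deGennesConstant_nonneg : 0 ≤ deGennesConstant :=
  Real.iInf_nonneg deGennesEnergy_nonneg

lemma integral_pow_mul_gaussian (n : ℕ) :
    IntegrableOn (fun t : ℝ => t ^ n * Real.exp (-t ^ 2)) (Ioi 0) ∧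
      ∫ t in Ioi (0 : ℝ), t ^ n * Real.exp (-t ^ 2) = 1 / 2 * Real.Gamma (((n : ℝ) + 1) / 2) := by
  have hn : (-1 : ℝ) < n := by linarith [(n.cast_nonneg : (0 : ℝ) ≤ n)]
  constructor
  · have h := integrableOn_rpow_mul_exp_neg_mul_sq (b := 1) one_pos hn
    simpa using h
  · have h := integral_rpow_mul_exp_neg_rpow (p := 2) (q := n) two_pos hn
    simpa using h

/-- The de Gennes constant is smaller than one. -/
lemma deGennesConstant_lt_one : deGennesConstant < 1 := by
  obtain ⟨i0, e0⟩ := integral_pow_mul_gaussian 0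
  obtain ⟨i1, e1⟩ := integral_pow_mul_gaussian 1
  obtain ⟨i2, e2⟩ := integral_pow_mul_gaussian 2
  set g := Real.Gamma (1 / 2) with hg
  have hg0 : 0 < g := Real.Gamma_pos_of_pos (by norm_num)
  have e0' : ∫ t in Ioi (0 : ℝ), t ^ 0 * Real.exp (-t ^ 2) = g / 2 := by
    rw [e0, hg]; norm_num; ring
  have e1' : ∫ t in Ioi (0 : ℝ), t ^ 1 * Real.exp (-t ^ 2) = 1 / 2 := by
    rw [e1]; norm_num
  have e2' : ∫ t in Ioi (0 : ℝ), t ^ 2 * Real.exp (-t ^ 2) = g / 4 := by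
    rw [e2, show ((2 : ℕ) + 1 : ℝ) / 2 = 1 / 2 + 1 by norm_num,
      Real.Gamma_add_one (by norm_num), ← hg]
    ring
  set c : ℝ := √(2 / g) with hc
  -- The trial state is the Gaussian `exp (-t² / 2)`, normalized on the half-line.
  have hc2 : c ^ 2 = 2 / g := Real.sq_sqrt (by positivity)
  set u : ℝ → ℂ := fun t => ((c * Real.exp (-t ^ 2 / 2) : ℝ) : ℂ) with hu
  set u' : ℝ → ℂ := fun t => ((c * (Real.exp (-t ^ 2 / 2) * -t) : ℝ) : ℂ) with hu'
  have hexp : ∀ t : ℝ, Real.exp (-t ^ 2 / 2) ^ 2 = Real.exp (-t ^ 2) := fun t => by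
    rw [← Real.exp_nat_mul]; congr 1; push_cast; ring
  have nu : ∀ t, ‖u t‖ ^ 2 = 2 / g * (t ^ 0 * Real.exp (-t ^ 2)) := fun t => by
    rw [hu]; dsimp only
    rw [Complex.norm_real, Real.norm_eq_abs, sq_abs, mul_pow, hexp, hc2, pow_zero, one_mul]
  have nu' : ∀ t, ‖u' t‖ ^ 2 = 2 / g * (t ^ 2 * Real.exp (-t ^ 2)) := fun t => by
    rw [hu']; dsimp only
    rw [Complex.norm_real, Real.norm_eq_abs, sq_abs, mul_pow, mul_pow, hexp, hc2]
    ring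
  have cu : Continuous u := by rw [hu]; fun_prop
  have cu' : Continuous u' := by rw [hu']; fun_prop
  have hder : ∀ t, HasDerivAt u (u' t) t := by
    intro t
    have h1 : HasDerivAt (fun t : ℝ => -t ^ 2 / 2) (-t) t := by
      refine (((hasDerivAt_pow 2 t).fun_neg).div_const 2).congr_deriv ?_
      norm_num
      ring
    exact ((h1.exp).const_mul c).ofReal_comp
  have hform : IsDeGennesForm u u' := by
    refine ⟨?_, ?_, ?_, fun t _ => ?_⟩
    · rw [memLp_two_iff_integrable_sq_norm cu.aestronglyMeasurable]
      simp_rw [nu]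
      exact i0.const_mul _
    · rw [memLp_two_iff_integrable_sq_norm cu'.aestronglyMeasurable]
      simp_rw [nu']
      exact i2.const_mul _
    · rw [memLp_two_iff_integrable_sq_norm
        (show Continuous fun t : ℝ => (t : ℂ) * u t from
          Complex.continuous_ofReal.mul cu).aestronglyMeasurable]
      simp_rw [norm_mul, mul_pow, nu, Complex.norm_real, Real.norm_eq_abs, sq_abs]
      refine (i2.const_mul (2 / g)).congr (Eventually.of_forall fun t => ?_)
      simp only
      ring
    · rw [intervalIntegral.integral_eq_sub_of_hasDerivAt (fun s _ => hder s)
        (cu'.intervalIntegrable _ _)]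
      ring
  have hnorm : (∫ t in Ioi (0 : ℝ), ‖u t‖ ^ 2) = 1 := by
    simp_rw [nu]
    rw [integral_const_mul, e0']
    field_simp
  -- The energy is `1 - 2 ξ / g + ξ²`, below 1 for small positive `ξ`. At this `ξ` it equals `1 - 3
  -- ξ²`.
  set ξ : ℝ := 1 / (2 * g) with hξ
  have hE : (∫ t in Ioi (0 : ℝ), (‖u' t‖ ^ 2 + (t - ξ) ^ 2 * ‖u t‖ ^ 2)) =
      1 - 2 * ξ / g + ξ ^ 2 := by
    have hpt : ∀ t : ℝ, ‖u' t‖ ^ 2 + (t - ξ) ^ 2 * ‖u t‖ ^ 2 =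
        (4 / g) * (t ^ 2 * Real.exp (-t ^ 2)) + (-(4 * ξ / g) * (t ^ 1 * Real.exp (-t ^ 2)) +
          (2 * ξ ^ 2 / g) * (t ^ 0 * Real.exp (-t ^ 2))) := fun t => by
      rw [nu, nu']; ring
    have j : IntegrableOn (fun t : ℝ => -(4 * ξ / g) * (t ^ 1 * Real.exp (-t ^ 2)) +
        (2 * ξ ^ 2 / g) * (t ^ 0 * Real.exp (-t ^ 2))) (Ioi 0) :=
      (i1.const_mul _).add (i0.const_mul _)
    simp_rw [hpt]
    rw [integral_add (i2.const_mul _) j,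
      integral_add (i1.const_mul _) (i0.const_mul _), integral_const_mul, integral_const_mul,
      integral_const_mul, e0', e1', e2']
    field_simp
    ring
  have hle : deGennesConstant ≤ 1 - 2 * ξ / g + ξ ^ 2 := by
    refine (ciInf_le ⟨0, ?_⟩ ξ).trans ?_
    · rintro _ ⟨ξ, rfl⟩; exact deGennesEnergy_nonneg ξ
    · exact csInf_le (deGennesEnergy_bddBelow ξ) ⟨u, u', hform, hnorm, hE.symm⟩
  have : 2 * ξ / g = 4 * ξ ^ 2 := by rw [hξ]; field_simp; ring
  have hξ0 : 0 < ξ := by positivity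
  nlinarith [sq_pos_of_pos hξ0]

/-! ### Choice of constants and conclusion -/

theorem mainTheorem8 (B R : ℝ) (hB : 0 < B) (hR : 0 < R) (V : Set Plane)
    (hV : ENNReal.ofReal (2 * R) < V.einfsep) :
    ∃ κ > 0, ∃ C > 0, ∃ h₀ > 0, ∀ h : ℝ, 0 < h → h < h₀ →
      ∀ Ψ : L2 (obstacleDomain V R),
        Ψ = spectralProjection (magneticNeumannLaplacian B h (obstacleDomain V R))
          (Set.Iic ((1 + deGennesConstant) / 2 * B * h)) Ψ →
        ∃ G : Fin 2 → L2 (obstacleDomain V R),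
          IsMagneticGradient B h (obstacleDomain V R) Ψ G ∧
          IntegrableOn (fun x => Real.exp (κ / √h * Metric.infDist x (frontier (obstacleDomain V R)))
            * (‖Ψ x‖ ^ 2 + h⁻¹ * ∑ j, ‖G j x‖ ^ 2)) (obstacleDomain V R) volume ∧
          (∫ x in obstacleDomain V R,
            Real.exp (κ / √h * Metric.infDist x (frontier (obstacleDomain V R)))
              * (‖Ψ x‖ ^ 2 + h⁻¹ * ∑ j, ‖G j x‖ ^ 2)) ≤ C * ‖Ψ‖ ^ 2 := by
  have hΩ := isOpen_obstacleDomain hR hV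
  set Ω := obstacleDomain V R
  have hΘ1 := deGennesConstant_lt_one
  have hΘ0 := deGennesConstant_nonneg
  set b : ℝ := (1 + deGennesConstant) / 2 * B with hb
  have hb0 : 0 ≤ b := by positivity
  have hbB : b < B := by rw [hb]; nlinarith
  -- Then `2 κ²` is half of the gap `B - b`.
  set κ : ℝ := √((B - b) / 4) with hκdef
  have hκ : 0 < κ := Real.sqrt_pos.2 (by linarith)
  have hκ2 : κ ^ 2 = (B - b) / 4 := Real.sq_sqrt (by linarith)
  obtain ⟨C, hC, hmain⟩ := exists_weighted_bound hB hb0 hκ (by rw [hκ2]; linarith)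
  -- The weight enters squared, which doubles the rate. The bounds hold for every `h > 0`, so `h₀ =
  -- 1` is arbitrary.
  refine ⟨2 * κ, by positivity, C, hC, 1, one_pos, fun h hh _ Ψ hΨ => ?_⟩
  have hsq : 0 < √h := Real.sqrt_pos.2 hh
  by_cases hE : ∃ E : SpectralResolution (L2 Ω), E.IsResolutionOf (magneticNeumannLaplacian B h Ω)
  swap
  -- Without a resolution the projection is 0 by default and `Ψ = 0`, so the spectral theorem is not
  -- needed here.
  · rw [spectralProjection, dif_neg hE] at hΨ
    have hΨ0 : Ψ = 0 := hΨ
    refine ⟨0, by rw [hΨ0]; exact IsMagneticGradient.zero B h Ω, ?_⟩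
    have hz : (fun x => Real.exp (2 * κ / √h * Metric.infDist x (frontier Ω)) *
        (‖Ψ x‖ ^ 2 + h⁻¹ * ∑ j, ‖(0 : Fin 2 → L2 Ω) j x‖ ^ 2)) =ᵐ[volume.restrict Ω] 0 := by
      rw [hΨ0]
      filter_upwards [Lp.coeFn_zero ℂ 2 (volume.restrict Ω)] with x hx
      simp only [Pi.zero_apply, hx, norm_zero]
      simp
    refine ⟨(integrable_zero _ _ _).congr hz.symm, ?_⟩
    rw [integral_congr_ae hz]
    simp only [Pi.zero_apply, integral_zero]
    positivity
  · rw [spectralProjection, dif_pos hE] at hΨ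
    obtain ⟨t, ht, htl, htd⟩ := exists_smooth_infDist Ωᶜ hsq
    have ht0 : ∀ x, 0 ≤ t x := fun x =>
      (div_nonneg Metric.infDist_nonneg hsq.le).trans (htd x).1
    -- Outside `Ω` the distance to the complement is 0, so `t ≤ 2` there.
    have hts : {x | 3 ≤ t x} ⊆ Ω := by
      intro x hx
      by_contra hcon
      have h1 := (htd x).2
      rw [Metric.infDist_zero_of_mem (mem_compl hcon)] at h1
      have h2 : 3 ≤ t x := hx
      norm_num at h1
      linarith
    obtain ⟨G, hG, hGf⟩ := hmain h hh Ω hΩ t ht htl hts hE.choose hE.choose_spec Ψ hΨ.symm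
    refine ⟨G, hG, ?_⟩
    set a : ℕ → ℝ := fun n => 1 / ((n : ℝ) + 1) with ha
    have ha0 : ∀ n, 0 < a n := fun n => by positivity
    have hat : Tendsto a atTop (𝓝 0) := tendsto_one_div_add_atTop_nhds_zero_nat
    choose f hf hfx hfd using fun n =>
      exists_weight ht ht0 (by positivity : 0 ≤ 1 / √h) htl hκ (ha0 n)
    have hW : IntegrableOn (fun x => ‖Ψ x‖ ^ 2 + h⁻¹ * ∑ j, ‖G j x‖ ^ 2) Ω :=
      (L2_integrable_norm_sq Ψ).add
        ((integrable_finsetSum _ fun j _ => L2_integrable_norm_sq (G j)).const_mul _)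
    refine integrableOn_and_le_of_weights (p := fun n x => f n x ^ 2) hΩ.measurableSet
      (by positivity) hW.1 (fun x => by positivity) (fun n x => by positivity) (fun n => ?_)
      (fun n => hGf (f n) (hf n) (fun x => ?_) (fun x hx => ?_) (fun j x => ?_)) ?_
      (fun x => by positivity) (fun x hx => ⟨Real.exp (κ * t x) ^ 2, ?_, ?_⟩)
    · refine Integrable.bdd_mul (c := ‖f n‖ ^ 2) hW ((f n).continuous.pow 2).aestronglyMeasurable
        (Eventually.of_forall fun x => ?_)
      rw [norm_pow]
      exact pow_le_pow_left₀ (norm_nonneg _) ((f n).norm_coe_le_norm x) 2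
    · rw [hfx]; exact Real.exp_pos _
    · rw [hfx, Real.exp_le_exp, mul_comm 4 κ]
      refine mul_le_mul_of_nonneg_left ((div_le_self (ht0 x) ?_).trans hx.le) hκ.le
      have := mul_nonneg (ha0 n).le (ht0 x)
      linarith
    · rw [div_eq_mul_one_div]; exact hfd n j x
    · exact Real.continuous_exp.comp (continuous_const.mul (Metric.continuous_infDist_pt _))
    · simp_rw [hfx]
      have h1 : Tendsto (fun n => 1 + a n * t x) atTop (𝓝 1) := by
        simpa using (hat.mul_const (t x)).const_add 1
      have h2 : Tendsto (fun n => κ * (t x / (1 + a n * t x))) atTop (𝓝 (κ * t x)) := by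
        simpa using ((tendsto_const_nhds (x := t x)).div h1 one_ne_zero).const_mul κ
      exact ((Real.continuous_exp.tendsto _).comp h2).pow 2
    -- Inside `Ω` the distance to the frontier is at most the distance to the complement, which is
    -- at most `√h * t x`.
    · rw [← Real.exp_nat_mul, Real.exp_le_exp]
      have h1 := infDist_frontier_le_infDist_compl hΩ hx
      have h2 := (htd x).1
      rw [div_le_iff₀ hsq] at h2
      rw [div_mul_eq_mul_div, div_le_iff₀ hsq]
      push_cast
      nlinarith
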